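/- **Setting.** Let $\Omega\subset\mathbb R^d$ be a bounded open set satisfying an interior cone condition: there are $\theta\in(0,\pi/2)$ and $\rho>0$ such that every $x\in\Omega$ admits a unit vector $\xi$ with $x+\lambda y\in\Omega$ for all $\lambda\in[0,\rho]$ and all unit vectors $y$ with $\langle y,\xi\rangle\ge\cos\theta$. Let $\Gamma=[0,1]\times\Omega$. A *Mercer kernel* on a space $X$ is a symmetric, separately continuous function $X\times X\to\mathbb R$ all of whose kernel matrices are positive semidefinite. Let $\mathbb L_0(\Omega;\mathbb R^d)$ be the space of bounded Lipschitz maps $f:\mathbb R^d\to\mathbb R^d$ vanishing outside $\Omega$ (hence on $\partial\Omega$), with norm $\sup_{x\in\Omega}|f(x)|+\sup_{x\ne y\in\Omega}\frac{|f(x)-f(y)|}{|x-y|}$, and let $\mathbb V=L^1([0,1];\mathbb L_0(\Omega;\mathbb R^d))$ (Bochner space, with its norm). Let $k\ge1$, and let $V$ be a Mercer kernel on $\Gamma$ with $V\in C^{2k}(\Gamma\times\Gamma)$, meaning that $V$ is $2k$ times continuously differentiable on $\Gamma\times\Gamma$ with bounded derivatives of all orders $\le 2k$. Let $\mathcal Q$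 be the RKHS of $\mathbb R^d$-valued functions on $\Gamma$ with the diagonal matrix-valued kernel $V(s,s')I$. Assume that $\mathcal Q$ is compactly embedded in $\mathbb V$ (extending the fields by zero outside $\Omega$), with embedding constant $C_{\mathcal Q}>0$: $\|v\|_{\mathbb V}\le C_{\mathcal Q}\|v\|_{\mathcal Q}$ for all $v\in\mathcal Q$. For $v\in\mathcal Q$ let $T(x;v)=\phi(1)$, where $\phi'(t)=v(t,\phi(t))$ on $[0,1]$, $\phi(0)=x\in\Omega$. For $r>0$ and a finite nonempty set $S\subset\Gamma$ of distinct points $s_1,\dots,s_M$ put $$\mathcal Q_r=\{v\in\mathcal Q:\|v\|_{\mathcal Q}^2\le r^2\},\qquad \mathcal Q_r^S=\Big\{\sum_{j=1}^M V(s_j,\cdot)\,c_j:\ c_j\in\mathbb R^d,\ \sum_{i,j=1}^M V(s_i,s_j)\langle c_i,c_j\rangle\le r^2\Big\},$$ and $h_S=\sup_{s\in\Gamma}\min_{s'\in S}|s-s'|$ (Euclidean distance in $\mathbb R^{1+d}$). For a Mercer kernel $K$ on $\Omega$ with RKHS $\mathcal K$, let $\mathbb P_K(\Omega)$ be the set of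 Borel probability measures $\mu$ on $\Omega$ with $\int_\Omega\sqrt{K(x,x)}\,d\mu(x)<\infty$, and $\mathrm{MMD}_K(\mu,\mu')=\big\|\int_\Omega K(x,\cdot)\,d\mu(x)-\int_\Omega K(x,\cdot)\,d\mu'(x)\big\|_{\mathcal K}$. **Proposition.** There exist $C>0$ and $h_0>0$, depending only on $\Omega$ (and $d$), $k$, $V$ and $C_{\mathcal Q}$, such that the following holds. Let $K$ be a Mercer kernel on $\Omega$ and $L_K>0$ with $\|K(x,\cdot)-K(x',\cdot)\|_{\mathcal K}\le L_K|x-x'|$ for all $x,x'\in\Omega$, let $\eta,\nu\in\mathbb P_K(\Omega)$, let $r>0$, and let $S\subset\Gamma$ be finite and nonempty with $h_S\le h_0$. If $v_r$ is any minimizer of $v\mapsto\mathrm{MMD}_K(T(\cdot;v)\#\eta,\nu)$ over $\mathcal Q_r$ and $v_r^S$ is any minimizer of the same functional over $\mathcal Q_r^S$, then $$\mathrm{MMD}_K(T(\cdot;v_r^S)\#\eta,\nu)\le C\,L_K\,\big(\exp(C_{\mathcal Q}r)-1\big)\,h_S^k+\mathrm{MMD}_K(T(\cdot;v_r)\#\eta,\nu).$$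 In particular $C$ is independent of $h_S$, $r$ and $v_r$. -/

import Mathlib

open MeasureTheory Set Filter
open scoped NNReal RealInnerProductSpace

noncomputable section

namespace KODE

/-! ### Mercer kernels, their reproducing kernel Hilbert spaces, and the MMD -/

/-- A (scalar) Mercer kernel on a topological space `X`: symmetric, positive definite in the sense
that all its kernel matrices are positive semidefinite, and continuous in each argument. -/
structure MercerKernel (X : Type*) [TopologicalSpace X] where
  /-- the kernel as a function of two variables -/
  toFun : X → X → ℝ
  symm : ∀ x y, toFun x y = toFun y x
  nonneg : ∀ (A : Finset X) (c : X → ℝ), 0 ≤ ∑ x ∈ A, ∑ y ∈ A, c x * c y * toFun x y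
  continuous_left : ∀ y, Continuous fun x => toFun x y
  continuous_right : ∀ x, Continuous fun y => toFun x y

namespace MercerKernel

variable {X : Type*} [TopologicalSpace X] (K : MercerKernel X)
variable (F : Type*) [NormedAddCommGroup F] [InnerProductSpace ℝ F] [CompleteSpace F]

/-- The diagonal operator-valued kernel `(x, y) ↦ K(x, y) I` with values in the operators on `F`. -/
def diag : Matrix X X (F →L[ℝ] F) :=
  Matrix.of fun x y => K.toFun x y • ContinuousLinearMap.id ℝ F

theorem diag_posSemidef [FiniteDimensional ℝ F] : (K.diag F).PosSemidef := by
  have key := (RKHS.posSemidef_tfae (K := K.diag F)).out 0 2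
  refine key.mpr ⟨?_, fun f => ?_⟩
  · ext1 x y
    simp only [diag, Matrix.conjTranspose_apply, Matrix.of_apply, star_smul, star_trivial]
    rw [K.symm y x]
    congr 1
    exact star_one (F →L[ℝ] F)
  · let b := stdOrthonormalBasis ℝ F
    have h : ∀ w w' : F, ⟪w, w'⟫ = ∑ i, ⟪b i, w⟫ * ⟪b i, w'⟫ := fun w w' => by
      rw [← b.sum_inner_mul_inner w w']
      exact Finset.sum_congr rfl fun i _ => by rw [real_inner_comm]
    have : (f.sum fun x w => f.sum fun x' w' => ⟪K.diag F x' x w, w'⟫)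
        = ∑ i, ∑ x ∈ f.support, ∑ y ∈ f.support, ⟪b i, f x⟫ * ⟪b i, f y⟫ * K.toFun x y := by
      simp only [Finsupp.sum, diag, Matrix.of_apply, smul_apply,
        ContinuousLinearMap.coe_id', id, inner_smul_left]
      rw [Finset.sum_comm]
      rw [Finset.sum_comm (s := Finset.univ)]
      rw [Finset.sum_comm]
      refine Finset.sum_congr rfl fun x _ => ?_
      rw [Finset.sum_comm]
      refine Finset.sum_congr rfl fun y _ => ?_
      rw [h, Finset.mul_sum]
      refine Finset.sum_congr rfl fun i _ => ?_
      rw [K.symm y x]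
      simp only [conj_trivial]
      ring
    rw [RCLike.re_to_real, this]
    exact Finset.sum_nonneg fun i _ => K.nonneg _ _

instance [FiniteDimensional ℝ F] : Fact (K.diag F).PosSemidef := ⟨K.diag_posSemidef F⟩

/-- The reproducing kernel Hilbert space, consisting of functions `X → F`, of the diagonal kernel
`K(x, y) I`. For `F = ℝ` this is the scalar RKHS of `K`. -/
abbrev Space [FiniteDimensional ℝ F] : Type _ := RKHS.OfKernel (K.diag F)

/-- The canonical feature `K(x, ·)`, an element of the scalar RKHS of `K`. -/
def feature (x : X) : K.Space ℝ := RKHS.kerFun (K.Space ℝ) x 1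

/-- The probability measures `μ` with `∫ √K(x, x) dμ < ∞`. -/
def IsAdmissible [MeasurableSpace X] (μ : Measure X) : Prop :=
  IsProbabilityMeasure μ ∧ Integrable (fun x => √(K.toFun x x)) μ

/-- The kernel mean embedding `μ ↦ ∫ K(x, ·) dμ(x)`. -/
def meanEmbedding [MeasurableSpace X] (μ : Measure X) : K.Space ℝ := ∫ x, K.feature x ∂μ

/-- The maximum mean discrepancy. -/
def mmd [MeasurableSpace X] (μ ν : Measure X) : ℝ := ‖K.meanEmbedding μ - K.meanEmbedding ν‖

/-- `‖K(x, ·) - K(x', ·)‖ ≤ L |x - x'|` in the RKHS of `K`. -/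
def FeatureLipschitz {X : Type*} [PseudoMetricSpace X] (K : MercerKernel X) (L : ℝ) : Prop :=
  ∀ x x', ‖K.feature x - K.feature x'‖ ≤ L * dist x x'

/-- The closed ball of radius `r` in the RKHS of `K(x, y) I`. -/
def ball [FiniteDimensional ℝ F] (r : ℝ) : Set (K.Space F) := {v | ‖v‖ ^ 2 ≤ r ^ 2}

/-- The functions `∑ s ∈ S, K(s, ·) c(s)` with `∑ s, s' ∈ S, K(s, s') ⟨c(s), c(s')⟩ ≤ r²`. -/
def inducingBall [FiniteDimensional ℝ F] (S : Finset X) (r : ℝ) : Set (K.Space F) :=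
  {v | ∃ c : X → F, v = ∑ s ∈ S, RKHS.kerFun (K.Space F) s (c s) ∧
    ∑ s ∈ S, ∑ s' ∈ S, K.toFun s s' * ⟪c s, c s'⟫ ≤ r ^ 2}

end MercerKernel

/-! ### The space-time domain -/

variable {d : ℕ}

/-- `Γ = [0, 1] × Ω`. -/
def spaceTime (Ω : Set (EuclideanSpace ℝ (Fin d))) : Set (ℝ × EuclideanSpace ℝ (Fin d)) :=
  Icc 0 1 ×ˢ Ω

/-- The interior cone condition: for some angle `θ ∈ (0, π/2)` and radius `ρ > 0`, every point of
`Ω` is the vertex of a cone of angle `θ` and radius `ρ` contained in `Ω`. -/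
def InteriorCone (Ω : Set (EuclideanSpace ℝ (Fin d))) : Prop :=
  ∃ θ ρ : ℝ, 0 < θ ∧ θ < Real.pi / 2 ∧ 0 < ρ ∧ ∀ x ∈ Ω, ∃ ξ : EuclideanSpace ℝ (Fin d), ‖ξ‖ = 1 ∧
    ∀ y : EuclideanSpace ℝ (Fin d), ‖y‖ = 1 → Real.cos θ ≤ ⟪y, ξ⟫ →
      ∀ l ∈ Icc 0 ρ, x + l • y ∈ Ω

/-- The fill distance `sup_{s ∈ Γ} min_{s' ∈ S} |s - s'|` of a finite nonempty `S ⊆ Γ`, with respect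
to the Euclidean distance of `ℝ × ℝᵈ`. -/
def fillDistance {Ω : Set (EuclideanSpace ℝ (Fin d))} (S : Finset (spaceTime Ω)) : ℝ :=
  ⨆ s : spaceTime Ω, ⨅ s' : S, √((s.1.1 - s'.1.1.1) ^ 2 + ‖s.1.2 - s'.1.1.2‖ ^ 2)

/-- `V ∈ Cⁿ(Γ × Γ)`: `V` is `n` times continuously differentiable on `Γ × Γ` (one-sidedly at the
end points of the time interval), with bounded derivatives of all orders up to `n`. The values of
`G` outside of `Γ × Γ` are irrelevant. -/
def IsCn (n : ℕ) {Ω : Set (EuclideanSpace ℝ (Fin d))} (V : MercerKernel (spaceTime Ω)) : Prop :=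
  ∃ G : (ℝ × EuclideanSpace ℝ (Fin d)) × (ℝ × EuclideanSpace ℝ (Fin d)) → ℝ,
    (∀ s s' : spaceTime Ω, G (s, s') = V.toFun s s') ∧
    ContDiffOn ℝ n G (spaceTime Ω ×ˢ spaceTime Ω) ∧
    ∀ m ≤ n, ∃ B : ℝ, ∀ p ∈ spaceTime Ω ×ˢ spaceTime Ω,
      ‖iteratedFDerivWithin ℝ m G (spaceTime Ω ×ˢ spaceTime Ω) p‖ ≤ B

/-! ### The spaces of Lipschitz vector fields -/

/-- The bounded Lipschitz vector fields on `ℝᵈ` that vanish outside of `Ω`. -/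
def lipZeroSubmodule (Ω : Set (EuclideanSpace ℝ (Fin d))) :
    Submodule ℝ (EuclideanSpace ℝ (Fin d) → EuclideanSpace ℝ (Fin d)) where
  carrier := {f | (∃ B : ℝ, ∀ x, ‖f x‖ ≤ B) ∧ (∃ L : ℝ≥0, LipschitzWith L f) ∧ ∀ x ∉ Ω, f x = 0}
  zero_mem' := ⟨⟨0, by simp⟩, ⟨0, LipschitzWith.const 0⟩, by simp⟩
  add_mem' := by
    rintro f g ⟨⟨B, hB⟩, ⟨L, hL⟩, hf⟩ ⟨⟨B', hB'⟩, ⟨L', hL'⟩, hg⟩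
    exact ⟨⟨B + B', fun x => (norm_add_le _ _).trans (add_le_add (hB x) (hB' x))⟩,
      ⟨L + L', hL.add hL'⟩, fun x hx => by simp [hf x hx, hg x hx]⟩
  smul_mem' := by
    rintro c f ⟨⟨B, hB⟩, ⟨L, hL⟩, hf⟩
    refine ⟨⟨‖c‖ * B, fun x => ?_⟩, ⟨‖c‖₊ * L, ?_⟩, fun x hx => by simp [hf x hx]⟩
    · rw [Pi.smul_apply, norm_smul]
      exact mul_le_mul_of_nonneg_left (hB x) (norm_nonneg c)
    · refine LipschitzWith.of_dist_le_mul fun x y => ?_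
      simp only [Pi.smul_apply, dist_smul₀, NNReal.coe_mul, coe_nnnorm, mul_assoc]
      exact mul_le_mul_of_nonneg_left (hL.dist_le_mul x y) (norm_nonneg c)

/-- The space `L₀(Ω; ℝᵈ)` of bounded Lipschitz vector fields that vanish outside of `Ω`. It is a type
of its own, so that it carries the topology of its norm and not that of pointwise convergence. -/
def LipZero (Ω : Set (EuclideanSpace ℝ (Fin d))) : Type := lipZeroSubmodule Ω

namespace LipZero

variable {Ω : Set (EuclideanSpace ℝ (Fin d))}

instance : AddCommGroup (LipZero Ω) := inferInstanceAs (AddCommGroup (lipZeroSubmodule Ω))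

instance : Module ℝ (LipZero Ω) := inferInstanceAs (Module ℝ (lipZeroSubmodule Ω))

theorem coe_add (f g : LipZero Ω) : (f + g).1 = f.1 + g.1 := rfl

theorem coe_smul (c : ℝ) (f : LipZero Ω) : (c • f).1 = c • f.1 := rfl

theorem coe_zero : (0 : LipZero Ω).1 = 0 := rfl

/-- `sup_{x ∈ Ω} |f(x)|`. -/
def supPart (f : LipZero Ω) : ℝ := ⨆ x : Ω, ‖f.1 x‖

/-- `sup_{x, y ∈ Ω} |f(x) - f(y)| / |x - y|`, where a quotient with `x = y` counts as `0`. -/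
def lipPart (f : LipZero Ω) : ℝ :=
  ⨆ p : Ω × Ω, ‖f.1 p.1 - f.1 p.2‖ / ‖(p.1 : EuclideanSpace ℝ (Fin d)) - p.2‖

theorem bddAbove_supPart (f : LipZero Ω) : BddAbove (range fun x : Ω => ‖f.1 x‖) := by
  obtain ⟨B, hB⟩ := f.2.1
  exact ⟨B, by rintro _ ⟨x, rfl⟩; exact hB x⟩

theorem bddAbove_lipPart (f : LipZero Ω) : BddAbove (range fun p : Ω × Ω =>
    ‖f.1 p.1 - f.1 p.2‖ / ‖(p.1 : EuclideanSpace ℝ (Fin d)) - p.2‖) := by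
  obtain ⟨L, hL⟩ := f.2.2.1
  refine ⟨L, ?_⟩
  rintro _ ⟨p, rfl⟩
  refine div_le_of_le_mul₀ (norm_nonneg _) L.2 ?_
  simpa [dist_eq_norm] using hL.dist_le_mul (p.1 : EuclideanSpace ℝ (Fin d)) p.2

/-- The norm `sup_{x ∈ Ω} |f(x)| + sup_{x, y ∈ Ω} |f(x) - f(y)| / |x - y|`. -/
instance : Norm (LipZero Ω) := ⟨fun f => supPart f + lipPart f⟩

theorem norm_def (f : LipZero Ω) : ‖f‖ = supPart f + lipPart f := rfl

theorem supPart_nonneg (f : LipZero Ω) : 0 ≤ supPart f := Real.iSup_nonneg fun _ => norm_nonneg _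

theorem lipPart_nonneg (f : LipZero Ω) : 0 ≤ lipPart f :=
  Real.iSup_nonneg fun _ => div_nonneg (norm_nonneg _) (norm_nonneg _)

theorem normCore : NormedSpace.Core ℝ (LipZero Ω) where
  norm_nonneg f := add_nonneg (supPart_nonneg f) (lipPart_nonneg f)
  norm_smul c f := by
    rw [norm_def, norm_def, mul_add]
    congr 1
    · simp only [supPart, Real.mul_iSup_of_nonneg (norm_nonneg c)]
      simp [coe_smul, norm_smul]
    · simp only [lipPart, Real.mul_iSup_of_nonneg (norm_nonneg c)]
      simp [coe_smul, ← smul_sub, norm_smul, mul_div_assoc]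
  norm_triangle f g := by
    have h1 : supPart (f + g) ≤ supPart f + supPart g :=
      Real.iSup_le (fun x => (norm_add_le (f.1 x) (g.1 x)).trans
        (add_le_add (le_ciSup (bddAbove_supPart f) x) (le_ciSup (bddAbove_supPart g) x)))
        (add_nonneg (supPart_nonneg f) (supPart_nonneg g))
    have h2 : lipPart (f + g) ≤ lipPart f + lipPart g := by
      refine Real.iSup_le (fun p => ?_) (add_nonneg (lipPart_nonneg f) (lipPart_nonneg g))
      refine le_trans ?_
        (add_le_add (le_ciSup (bddAbove_lipPart f) p) (le_ciSup (bddAbove_lipPart g) p))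
      rw [← add_div]
      refine div_le_div_of_nonneg_right ?_ (norm_nonneg _)
      refine le_trans (le_of_eq ?_) (norm_add_le _ _)
      congr 1
      simp only [coe_add, Pi.add_apply]
      abel
    rw [norm_def, norm_def, norm_def]
    linarith
  norm_eq_zero_iff f := by
    constructor
    · intro h
      rw [norm_def] at h
      have h0 : supPart f = 0 := by linarith [supPart_nonneg f, lipPart_nonneg f]
      refine Subtype.ext (funext fun x => ?_)
      by_cases hx : x ∈ Ω
      · have := le_ciSup (bddAbove_supPart f) ⟨x, hx⟩
        rw [← supPart, h0] at this
        simpa [coe_zero] using this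
      · simpa [coe_zero] using f.2.2.2 x hx
    · rintro rfl
      simp [norm_def, supPart, lipPart, coe_zero]

instance : NormedAddCommGroup (LipZero Ω) := NormedAddCommGroup.ofCore normCore

instance : NormedSpace ℝ (LipZero Ω) := NormedSpace.ofCore normCore

end LipZero

/-- The Bochner space `L¹([0, 1]; L₀(Ω; ℝᵈ))` of time-dependent vector fields, with norm
`∫₀¹ sup_x |v(t, x)| dt + ∫₀¹ sup_{x, y} |v(t, x) - v(t, y)| / |x - y| dt`. -/
abbrev VelocitySpace (Ω : Set (EuclideanSpace ℝ (Fin d))) : Type :=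
  Lp (LipZero Ω) 1 (volume.restrict (Icc (0 : ℝ) 1))

open Classical in
/-- The extension by zero of a vector field on `Γ = [0, 1] × Ω`, as a function of `t` and `x`. -/
def zeroExt {Ω : Set (EuclideanSpace ℝ (Fin d))} (v : spaceTime Ω → EuclideanSpace ℝ (Fin d))
    (t : ℝ) (x : EuclideanSpace ℝ (Fin d)) : EuclideanSpace ℝ (Fin d) :=
  if h : (t, x) ∈ spaceTime Ω then v ⟨(t, x), h⟩ else 0

/-- The RKHS of the diagonal kernel `V I` is compactly embedded in `L¹([0, 1]; L₀(Ω; ℝᵈ))`, with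
embedding constant `C`. -/
def CompactlyEmbedded {Ω : Set (EuclideanSpace ℝ (Fin d))} (V : MercerKernel (spaceTime Ω))
    (C : ℝ) : Prop :=
  ∃ ι : V.Space (EuclideanSpace ℝ (Fin d)) →L[ℝ] VelocitySpace Ω,
    (∀ v, ∀ᵐ t ∂(volume.restrict (Icc (0 : ℝ) 1)), (ι v t).1 = zeroExt v t) ∧
    IsCompactOperator ι ∧ ∀ v, ‖ι v‖ ≤ C * ‖v‖

/-! ### Transport maps -/

/-- `φ` is a solution in `Ω` on `[0, 1]` of `φ' = v(t, φ)`, `φ(0) = x`. -/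
def IsTrajectory {Ω : Set (EuclideanSpace ℝ (Fin d))}
    (v : spaceTime Ω → EuclideanSpace ℝ (Fin d)) (x : EuclideanSpace ℝ (Fin d))
    (φ : ℝ → EuclideanSpace ℝ (Fin d)) : Prop :=
  φ 0 = x ∧ ∀ t (ht : t ∈ Icc (0 : ℝ) 1), ∃ hφ : φ t ∈ Ω,
    HasDerivWithinAt φ (v ⟨(t, φ t), ht, hφ⟩) (Icc 0 1) t

open Classical in
/-- The transport map `T(x; v) = φ(1)`, where `φ' = v(t, φ)`, `φ(0) = x` (and `T(x; v) = x` if there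
is no solution, which does not happen for the vector fields considered here). -/
def transport {Ω : Set (EuclideanSpace ℝ (Fin d))}
    (v : spaceTime Ω → EuclideanSpace ℝ (Fin d)) (x : Ω) : Ω :=
  if h : ∃ φ, IsTrajectory v x φ then
    ⟨h.choose 1, (h.choose_spec.2 1 (right_mem_Icc.2 zero_le_one)).1⟩
  else x

/-- The loss `MMD_K(T(·; v)#η, ν)`. -/
def loss {Ω : Set (EuclideanSpace ℝ (Fin d))} (K : MercerKernel Ω) (η ν : Measure Ω)
    (v : spaceTime Ω → EuclideanSpace ℝ (Fin d)) : ℝ :=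
  K.mmd (η.map (transport v)) ν

end KODE

end

noncomputable section

namespace KODE

/-! ### Functionals that annihilate polynomials -/

/-! Project `vr` orthogonally onto the span of the fields `V(s, ·) c` with `s ∈ S`. The projection
`w` has norm at most `‖vr‖`, so it competes in the inducing ball, and by the reproducing property
`vr - w` vanishes on `S`. It remains to compare the losses of `vr` and `w`.

The sampling inequality `IsCn.exists_sampling` gives `|vr - w| ≤ C h^k r` on `Γ`. It is proved
without differentiating functions of the RKHS: the dual norm squared of a point functional `∑ aᵢ
δ_{sᵢ}` is `∑ aᵢ aⱼ V(sᵢ, sⱼ)`. If the functional annihilates polynomials of degree below `2k` along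
a segment, Taylor approximation in one argument of `V` bounds this by the length to the power `2k`,
and the square root leaves the power `k`. Interpolation along a segment through a nearby zero bounds
the function at centres of balls in `Γ`; extrapolation along a cone direction carries the bound to
every point. Both errors contain a small multiple of the supremum, which is absorbed.

Grönwall's inequality gives `|T(x; vr) - T(x; w)| ≤ ε exp(∫ Lip w(t, ·) dt)` with `ε = C h^k r`.
Bounding the exponent by `CQ * r` would leave a factor `r * exp(CQ * r)`, too large for a constant
independent of `r`. Compactness of the embedding saves the factor: the Lipschitz part of the Bochner
norm is at most `β ‖v‖` for some `β < CQ`, and `r * exp(β * r) ≤ (exp(CQ * r) - 1) / (CQ - β)`.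
Lipschitz continuity of the feature map turns the distance of the transport maps into one of mean
embeddings. -/

theorem exists_polynomial_approx (n : ℕ) : ∀ (f : ℕ → ℝ → ℝ) (B : ℝ),
    (∀ m < n, ∀ x ∈ Icc (0 : ℝ) 1, HasDerivWithinAt (f m) (f (m + 1) x) (Icc 0 1) x) →
    (∀ x ∈ Icc (0 : ℝ) 1, |f n x| ≤ B) →
    ∃ c : ℕ → ℝ, ∀ x ∈ Icc (0 : ℝ) 1, |f 0 x - ∑ j ∈ Finset.range n, c j * x ^ j| ≤ B := by
  induction n with
  | zero => intro f B _ hB; exact ⟨0, by simpa using hB⟩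
  | succ n ih =>
    intro f B hf hB
    obtain ⟨c, hc⟩ := ih (fun m => f (m + 1)) B (fun m hm => hf (m + 1) (by omega)) hB
    -- The polynomial is the antiderivative, with constant term `f 0 0`, of the one approximating `f
    -- 1`. The mean value inequality on an interval of length 1 preserves the bound `B`.
    refine ⟨fun j => if j = 0 then f 0 0 else c (j - 1) / j, fun x hx => ?_⟩
    have hB0 : 0 ≤ B := (abs_nonneg _).trans (hB x hx)
    set q : ℝ → ℝ := fun x => ∑ j ∈ Finset.range n, c j / ((j : ℝ) + 1) * x ^ (j + 1) with hq
    have hq' : ∀ y, HasDerivAt q (∑ j ∈ Finset.range n, c j * y ^ j) y := fun y => by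
      refine HasDerivAt.fun_sum fun j _ => ?_
      refine ((hasDerivAt_pow (j + 1) y).const_mul (c j / ((j : ℝ) + 1))).congr_deriv ?_
      rw [Nat.add_sub_cancel, Nat.cast_succ]
      field_simp
    have key := Convex.norm_image_sub_le_of_norm_hasDerivWithin_le
      (f := fun y => f 0 y - q y) (C := B) (s := Icc (0 : ℝ) 1) (x := 0) (y := x)
      (fun y hy => (hf 0 (by omega) y hy).sub (hq' y).hasDerivWithinAt)
      (fun y hy => by simpa using hc y hy) (convex_Icc 0 1) (by simp) hx
    have hq0 : q 0 = 0 := by simp [hq]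
    rw [Finset.sum_range_succ']
    simp only [hq0, Real.norm_eq_abs, sub_zero] at key
    rw [abs_of_nonneg hx.1] at key
    refine le_trans (le_of_eq ?_) (key.trans (mul_le_of_le_one_right hB0 hx.2))
    congr 1
    simp [hq]
    ring

/-- The functional `f ↦ ∑ aᵢ f(τᵢ)` annihilates the polynomials of degree less than `n`, and
its nodes lie in `[0, 1]`. -/
structure Annihilates {N : ℕ} (n : ℕ) (a τ : Fin N → ℝ) : Prop where
  mem : ∀ i, τ i ∈ Icc (0 : ℝ) 1
  sum_eq_zero : ∀ j < n, ∑ i, a i * τ i ^ j = 0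

theorem Annihilates.abs_sum_le {N n : ℕ} {a τ : Fin N → ℝ} (h : Annihilates n a τ)
    {f : ℕ → ℝ → ℝ} {B : ℝ}
    (hf : ∀ m < n, ∀ x ∈ Icc (0 : ℝ) 1, HasDerivWithinAt (f m) (f (m + 1) x) (Icc 0 1) x)
    (hB : ∀ x ∈ Icc (0 : ℝ) 1, |f n x| ≤ B) :
    |∑ i, a i * f 0 (τ i)| ≤ (∑ i, |a i|) * B := by
  obtain ⟨c, hc⟩ := exists_polynomial_approx n f B hf hB
  have h0 : ∑ i, a i * ∑ j ∈ Finset.range n, c j * τ i ^ j = 0 := by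
    simp_rw [Finset.mul_sum]
    rw [Finset.sum_comm]
    refine Finset.sum_eq_zero fun j hj => ?_
    rw [← mul_zero (c j), ← h.sum_eq_zero j (Finset.mem_range.1 hj), Finset.mul_sum]
    exact Finset.sum_congr rfl fun i _ => by ring
  rw [← sub_zero (∑ i, a i * f 0 (τ i)), ← h0, ← Finset.sum_sub_distrib, Finset.sum_mul]
  refine (Finset.abs_sum_le_sum_abs _ _).trans (Finset.sum_le_sum fun i _ => ?_)
  rw [← mul_sub, abs_mul]
  exact mul_le_mul_of_nonneg_left (hc _ (h.mem i)) (abs_nonneg _)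

theorem Annihilates.abs_sum_segment_le {X : Type*} [NormedAddCommGroup X] [NormedSpace ℝ X]
    {N n : ℕ} {a τ : Fin N → ℝ} (h : Annihilates n a τ) {G : X → ℝ} {S : Set X}
    (hS : UniqueDiffOn ℝ S) (hG : ContDiffOn ℝ n G S) {B : ℝ}
    (hB : ∀ p ∈ S, ‖iteratedFDerivWithin ℝ n G S p‖ ≤ B) {p v : X}
    (hp : ∀ t ∈ Icc (0 : ℝ) 1, p + t • v ∈ S) :
    |∑ i, a i * G (p + τ i • v)| ≤ (∑ i, |a i|) * (B * ‖v‖ ^ n) := by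
  refine h.abs_sum_le
    (f := fun m t => iteratedFDerivWithin ℝ m G S (p + t • v) (fun _ => v)) ?_ ?_
  · intro m hm t ht
    have h1 : DifferentiableWithinAt ℝ (iteratedFDerivWithin ℝ m G S) S (p + t • v) :=
      hG.differentiableOn_iteratedFDerivWithin (by exact_mod_cast hm) hS _ (hp t ht)
    have h2 : HasDerivWithinAt (fun t : ℝ => p + t • v) v (Icc 0 1) t := by
      simpa using (((hasDerivAt_id t).smul_const v).const_add p).hasDerivWithinAt
    have h3 := h1.hasFDerivWithinAt.comp_hasDerivWithinAt t h2 (fun s hs => hp s hs)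
    have h4 := ((ContinuousMultilinearMap.apply ℝ (fun _ : Fin m => X) ℝ
      (fun _ => v)).hasFDerivAt (x := iteratedFDerivWithin ℝ m G S (p + t • v))
      ).comp_hasDerivWithinAt t h3
    rw [iteratedFDerivWithin_succ_apply_left]
    exact h4
  · intro t ht
    refine ((iteratedFDerivWithin ℝ n G S (p + t • v)).le_opNorm _).trans ?_
    simpa using mul_le_mul_of_nonneg_right (hB _ (hp t ht)) (by positivity)

/-- Lagrange interpolation at distinct nodes, as a functional that annihilates polynomials. -/
theorem annihilates_lagrange {n : ℕ} {v : ℕ → ℝ} (hv : InjOn v (Finset.range n)) {t : ℝ}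
    (ht : t ∈ Icc (0 : ℝ) 1) (hmem : ∀ i < n, v i ∈ Icc (0 : ℝ) 1) :
    Annihilates (N := n + 1) n
      (Fin.cons 1 fun i : Fin n => -(Lagrange.basis (Finset.range n) v i).eval t)
      (Fin.cons t fun i : Fin n => v i) := by
  refine ⟨fun i => ?_, fun j hj => ?_⟩
  · refine Fin.cases ht (fun i => hmem i i.2) i
  · have h := Lagrange.eq_interpolate_of_eval_eq (f := (Polynomial.X : Polynomial ℝ) ^ j)
      (fun i => v i ^ j) hv (by simpa using hj) (by simp)
    have h2 := congrArg (Polynomial.eval t) h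
    simp only [Lagrange.interpolate_apply, Polynomial.eval_finsetSum, Polynomial.eval_mul,
      Polynomial.eval_C, Polynomial.eval_pow, Polynomial.eval_X] at h2
    rw [Fin.sum_univ_succ]
    simp only [Fin.cons_zero, Fin.cons_succ, one_mul]
    rw [h2, ← Fin.sum_univ_eq_sum_range (fun i => v i ^ j * Polynomial.eval t
      (Lagrange.basis (Finset.range n) v i)), ← Finset.sum_add_distrib]
    exact Finset.sum_eq_zero fun i _ => by ring

theorem annihilates_secondDifference :
    Annihilates (N := 3) 2 ![1, -2, 1] ![0, 1 / 2, 1] := by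
  refine ⟨fun i => ?_, fun j hj => ?_⟩
  · fin_cases i <;> norm_num
  · interval_cases j
    · simp [Fin.sum_univ_succ]; norm_num
    · simp [Fin.sum_univ_succ]

/-! ### Functionals on the reproducing kernel Hilbert space -/

namespace MercerKernel

variable {X : Type*} [TopologicalSpace X] (K : MercerKernel X)
variable {F : Type*} [NormedAddCommGroup F] [InnerProductSpace ℝ F] [CompleteSpace F]
  [FiniteDimensional ℝ F]

theorem inner_kerFun_kerFun (s s' : X) (c c' : F) :
    ⟪RKHS.kerFun (K.Space F) s c, RKHS.kerFun (K.Space F) s' c'⟫ = K.toFun s s' * ⟪c, c'⟫ := by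
  rw [← RKHS.kernel_inner, RKHS.OfKernel.kernel_ofKernel, K.symm s s']
  simp [diag, inner_smul_left]

/-- The square root is the norm of the functional `∑ aᵢ δ_{sᵢ}`. For vector values, pair `u` with `∑
aᵢ K(sᵢ, ·) w`, where `w` is the value to be bounded, and apply Cauchy–Schwarz. -/
theorem norm_sum_smul_apply_le {N : ℕ} (a : Fin N → ℝ) (s : Fin N → X) (u : K.Space F) :
    ‖∑ i, a i • u (s i)‖ ≤ ‖u‖ * √(∑ i, ∑ j, a i * a j * K.toFun (s i) (s j)) := by
  set w := ∑ i, a i • u (s i) with hw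
  set g : K.Space F := ∑ i, a i • RKHS.kerFun (K.Space F) (s i) w with hg
  have h1 : ⟪u, g⟫ = ‖w‖ ^ 2 := by
    rw [← real_inner_self_eq_norm_sq]
    nth_rw 2 [hw]
    rw [hg, inner_sum, sum_inner]
    exact Finset.sum_congr rfl fun i _ => by
      rw [inner_smul_right, RKHS.inner_kerFun, inner_smul_left]; rfl
  have h2 : ‖g‖ ^ 2 = (∑ i, ∑ j, a i * a j * K.toFun (s i) (s j)) * ‖w‖ ^ 2 := by
    rw [← real_inner_self_eq_norm_sq, hg, sum_inner, Finset.sum_mul]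
    refine Finset.sum_congr rfl fun i _ => ?_
    rw [inner_sum, Finset.sum_mul]
    refine Finset.sum_congr rfl fun j _ => ?_
    rw [inner_smul_left, inner_smul_right, inner_kerFun_kerFun, real_inner_self_eq_norm_sq]
    simp only [conj_trivial]
    ring
  have h3 : ‖g‖ = √(∑ i, ∑ j, a i * a j * K.toFun (s i) (s j)) * ‖w‖ := by
    rw [← Real.sqrt_sq (norm_nonneg g), h2, Real.sqrt_mul' _ (sq_nonneg _),
      Real.sqrt_sq (norm_nonneg w)]
  have h4 := real_inner_le_norm u g
  rw [h1, h3] at h4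
  by_cases h0 : ‖w‖ = 0
  · rw [h0]; positivity
  · have : 0 < ‖w‖ := lt_of_le_of_ne (norm_nonneg _) (Ne.symm h0)
    nlinarith

theorem norm_apply_le_sqrt (u : K.Space F) (s : X) : ‖u s‖ ≤ ‖u‖ * √(K.toFun s s) := by
  simpa using K.norm_sum_smul_apply_le (N := 1) (fun _ => 1) (fun _ => s) u

theorem norm_sub_apply_le (u : K.Space F) (s s' : X) :
    ‖u s - u s'‖ ≤
      ‖u‖ * √(K.toFun s s - K.toFun s s' - K.toFun s' s + K.toFun s' s') := by
  have := K.norm_sum_smul_apply_le ![1, -1] ![s, s'] u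
  simp [Fin.sum_univ_two] at this
  refine le_trans (le_of_eq (by rw [sub_eq_add_neg])) (this.trans (le_of_eq ?_))
  congr 2
  ring

end MercerKernel

variable {d : ℕ}

/-! ### Interpolation constants -/

theorem injOn_succ_div (n : ℕ) :
    InjOn (fun i : ℕ => ((i : ℝ) + 1) / n) (Finset.range n) := by
  intro i hi j _ h
  have hn : (n : ℝ) ≠ 0 := by
    have := Finset.mem_range.1 hi
    exact_mod_cast (by omega : n ≠ 0)
  have : (i : ℝ) + 1 = j + 1 := (div_left_inj' hn).1 h
  exact_mod_cast add_right_cancel this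

theorem injOn_div (n : ℕ) : InjOn (fun i : ℕ => (i : ℝ) / n) (Finset.range n) := by
  intro i hi j _ h
  have hn : (n : ℝ) ≠ 0 := by
    have := Finset.mem_range.1 hi
    exact_mod_cast (by omega : n ≠ 0)
  exact_mod_cast (div_left_inj' hn).1 h

/-- The nodes avoid `0`, the vertex of the cone in the application, so balls of radius proportional
to the cone length fit around them. -/
theorem exists_annihilates_extrapolation (n : ℕ) :
    ∃ a : Fin n → ℝ, Annihilates (N := n + 1) n (Fin.cons 1 a)
      (Fin.cons 0 fun i : Fin n => ((i : ℝ) + 1) / n) := by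
  refine ⟨_, annihilates_lagrange (injOn_succ_div n) (by simp) fun i hi => ⟨by positivity, ?_⟩⟩
  have : (0 : ℝ) < n := by exact_mod_cast (by omega : 0 < n)
  rw [div_le_one this]
  exact_mod_cast hi

/-- Every Lagrange basis polynomial except the one of the node `0` vanishes at `0`, hence is `O(t)`
at `t`. If the function is zero at the node `0`, only weights of size `O(t)` remain. -/
theorem exists_annihilates_interpolation (n : ℕ) :
    ∃ D, 0 ≤ D ∧ ∀ t ∈ Icc (0 : ℝ) 1, ∃ a : Fin n → ℝ,
      Annihilates (N := n + 1) n (Fin.cons 1 a) (Fin.cons t fun i : Fin n => (i : ℝ) / n) ∧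
      (∀ i, |a i| ≤ D) ∧ ∀ i : Fin n, (i : ℕ) ≠ 0 → |a i| ≤ D * t := by
  set v : ℕ → ℝ := fun i => (i : ℝ) / n with hv
  set l : Fin n → Polynomial ℝ := fun i => Lagrange.basis (Finset.range n) v i with hl
  have h1 : ∀ i, ∃ D, 0 ≤ D ∧ ∀ t ∈ Icc (0 : ℝ) 1,
      |(l i).eval t| ≤ D ∧ |(l i).derivative.eval t| ≤ D := by
    intro i
    obtain ⟨D1, h1⟩ := isCompact_Icc.exists_bound_of_continuousOn (s := Icc (0 : ℝ) 1)
      (l i).continuous.continuousOn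
    obtain ⟨D2, h2⟩ := isCompact_Icc.exists_bound_of_continuousOn (s := Icc (0 : ℝ) 1)
      (l i).derivative.continuous.continuousOn
    refine ⟨max (max D1 D2) 0, le_max_right _ _, fun t ht => ⟨(h1 t ht).trans ?_,
      (h2 t ht).trans ?_⟩⟩
    · exact (le_max_left _ _).trans (le_max_left _ _)
    · exact (le_max_right _ _).trans (le_max_left _ _)
  choose D hD0 hD using h1
  have hle : ∀ i, D i ≤ ∑ j, D j := fun i =>
    Finset.single_le_sum (fun j _ => hD0 j) (Finset.mem_univ i)
  refine ⟨∑ i, D i, Finset.sum_nonneg fun i _ => hD0 i, fun t ht => ⟨_,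
    annihilates_lagrange (injOn_div n) ht fun i hi => ⟨by positivity, ?_⟩, fun i => ?_,
    fun i hi => ?_⟩⟩
  · have : (0 : ℝ) < n := by exact_mod_cast (by omega : 0 < n)
    rw [div_le_one this]
    exact_mod_cast hi.le
  · rw [abs_neg]
    exact (hD i t ht).1.trans (hle i)
  · rw [abs_neg]
    have h0 : (l i).eval 0 = 0 := by
      have hn : 0 ∈ Finset.range n := Finset.mem_range.2 (by have := i.2; omega)
      simpa [hv] using Lagrange.eval_basis_of_ne (v := v) hi hn
    have key := Convex.norm_image_sub_le_of_norm_hasDerivWithin_le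
      (f := fun t => (l i).eval t) (C := D i) (s := Icc (0 : ℝ) 1) (x := 0) (y := t)
      (fun y _ => ((l i).hasDerivAt y).hasDerivWithinAt)
      (fun y hy => (hD i y hy).2) (convex_Icc 0 1) (by simp) ht
    rw [h0, sub_zero, sub_zero, Real.norm_eq_abs, Real.norm_eq_abs, abs_of_nonneg ht.1] at key
    exact key.trans (mul_le_mul_of_nonneg_right (hle i) ht.1)

/-! ### Consequences of the smoothness of the kernel -/

variable {Ω : Set (EuclideanSpace ℝ (Fin d))}

theorem uniqueDiffOn_spaceTime (hΩ : IsOpen Ω) : UniqueDiffOn ℝ (spaceTime Ω) :=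
  (uniqueDiffOn_Icc zero_lt_one).prod hΩ.uniqueDiffOn

theorem IsCn.exists_annihilates_bound (hΩ : IsOpen Ω) {n m : ℕ}
    {V : MercerKernel (spaceTime Ω)} (hV : IsCn n V) (hm : m ≤ n) :
    ∃ B, 0 ≤ B ∧ ∀ {N : ℕ} {a τ : Fin N → ℝ}, Annihilates m a τ →
      ∀ (s s' : Fin N → spaceTime Ω) (p p' v v' : ℝ × EuclideanSpace ℝ (Fin d)),
      (∀ i, (s i : ℝ × EuclideanSpace ℝ (Fin d)) = p + τ i • v) →
      (∀ i, (s' i : ℝ × EuclideanSpace ℝ (Fin d)) = p' + τ i • v') →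
      (∀ t ∈ Icc (0 : ℝ) 1, p + t • v ∈ spaceTime Ω) →
      (∀ t ∈ Icc (0 : ℝ) 1, p' + t • v' ∈ spaceTime Ω) →
      |∑ i, a i * V.toFun (s i) (s' i)| ≤ (∑ i, |a i|) * (B * max ‖v‖ ‖v'‖ ^ m) := by
  obtain ⟨G, hGV, hG, hB⟩ := hV
  obtain ⟨B, hB⟩ := hB m hm
  refine ⟨max B 0, le_max_right _ _, fun {N a τ} h s s' p p' v v' hs hs' hp hp' => ?_⟩
  have hS := (uniqueDiffOn_spaceTime hΩ).prod (uniqueDiffOn_spaceTime hΩ)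
  have := h.abs_sum_segment_le hS (hG.of_le (by exact_mod_cast hm))
    (fun q hq => (hB q hq).trans (le_max_left B 0)) (p := (p, p')) (v := (v, v'))
    (fun t ht => ⟨hp t ht, hp' t ht⟩)
  rw [Prod.norm_mk] at this
  refine le_trans (le_of_eq ?_) this
  congr 1
  refine Finset.sum_congr rfl fun i _ => ?_
  rw [← hGV, hs, hs']
  rfl

theorem IsCn.exists_diag_le (hΩ : IsOpen Ω) {n : ℕ} {V : MercerKernel (spaceTime Ω)}
    (hV : IsCn n V) :
    ∃ B, 0 ≤ B ∧ ∀ s, V.toFun s s ≤ B := by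
  obtain ⟨B, hB0, hB⟩ := hV.exists_annihilates_bound hΩ (Nat.zero_le n)
  refine ⟨B, hB0, fun s => (le_abs_self _).trans ?_⟩
  have := hB (N := 1) (a := fun _ => 1) (τ := fun _ => 0) ⟨by simp, by simp⟩ (fun _ => s)
    (fun _ => s) s s 0 0 (by simp) (by simp) (by simp) (by simp)
  simpa using this

/-- The functions of the RKHS are Lipschitz along segments. -/
theorem IsCn.exists_lipschitz (hΩ : IsOpen Ω) {n : ℕ} {V : MercerKernel (spaceTime Ω)}
    (hV : IsCn n V) (hn : 2 ≤ n) :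
    ∃ B, 0 ≤ B ∧ ∀ (u : V.Space (EuclideanSpace ℝ (Fin d))) (s s' : spaceTime Ω),
      (∀ t ∈ Icc (0 : ℝ) 1, s.1 + t • (s'.1 - s.1) ∈ spaceTime Ω) →
      ‖u s - u s'‖ ≤ ‖u‖ * (B * ‖s'.1 - s.1‖) := by
  obtain ⟨B, hB0, hB⟩ := hV.exists_annihilates_bound hΩ hn
  refine ⟨√(8 * B), Real.sqrt_nonneg _, fun u s s' h => ?_⟩
  refine (V.norm_sub_apply_le u s s').trans (mul_le_mul_of_nonneg_left ?_ (norm_nonneg u))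
  set w := s'.1 - s.1 with hw
  have hmid : s.1 + (1 / 2 : ℝ) • w ∈ spaceTime Ω := h _ (by norm_num)
  set m : spaceTime Ω := ⟨_, hmid⟩ with hm
  have h1 : ∀ i, ((![s, m, s'] i : spaceTime Ω) : ℝ × EuclideanSpace ℝ (Fin d))
      = s.1 + (![0, 1 / 2, 1] : Fin 3 → ℝ) i • w := by
    intro i; fin_cases i <;> simp [hm, hw]
  have h2 : ∀ i, ((![s', m, s] i : spaceTime Ω) : ℝ × EuclideanSpace ℝ (Fin d))
      = s'.1 + (![0, 1 / 2, 1] : Fin 3 → ℝ) i • (-w) := by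
    intro i
    fin_cases i
    · simp
    · simp only [hm, hw]
      simp
      module
    · simp [hw]
  have h' : ∀ t ∈ Icc (0 : ℝ) 1, s'.1 + t • (-w) ∈ spaceTime Ω := fun t ht => by
    convert h (1 - t) ⟨by linarith [ht.2], by linarith [ht.1]⟩ using 1
    rw [hw]
    module
  -- The mixed difference of `V` is a difference of two second differences, along the diagonal and
  -- the antidiagonal of the square with vertices in `{s, s'}`. They share the midpoint `(m, m)`,
  -- which cancels. Each costs `4 * B * ‖w‖ ^ 2`, whence the 8.
  have e1 := hB annihilates_secondDifference _ _ _ _ _ _ h1 h1 h h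
  have e2 := hB annihilates_secondDifference _ _ _ _ _ _ h1 h2 h h'
  simp [Fin.sum_univ_succ] at e1 e2
  rw [abs_le] at e1 e2
  refine Real.sqrt_le_iff.2 ⟨by positivity, ?_⟩
  rw [mul_pow, Real.sq_sqrt (by positivity)]
  have := V.symm s s'
  norm_num at e1 e2
  linarith [e1.2, e2.1]

/-- The action of functionals that annihilate polynomials on the functions of the RKHS. -/
theorem IsCn.exists_norm_sum_le (hΩ : IsOpen Ω) {k : ℕ} {V : MercerKernel (spaceTime Ω)}
    (hV : IsCn (2 * k) V) :
    ∃ B, 0 ≤ B ∧ ∀ {N : ℕ} {a τ : Fin N → ℝ}, Annihilates (2 * k) a τ →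
      ∀ (u : V.Space (EuclideanSpace ℝ (Fin d))) (s : Fin N → spaceTime Ω)
        (p v : ℝ × EuclideanSpace ℝ (Fin d)),
      (∀ i, (s i : ℝ × EuclideanSpace ℝ (Fin d)) = p + τ i • v) →
      (∀ t ∈ Icc (0 : ℝ) 1, p + t • v ∈ spaceTime Ω) →
      ‖∑ i, a i • u (s i)‖ ≤ ‖u‖ * ((∑ i, |a i|) * (B * ‖v‖ ^ k)) := by
  obtain ⟨B, hB0, hB⟩ := hV.exists_annihilates_bound hΩ le_rfl
  refine ⟨√B, Real.sqrt_nonneg _, fun {N a τ} h u s p v hs hp => ?_⟩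
  refine (V.norm_sum_smul_apply_le a s u).trans (mul_le_mul_of_nonneg_left ?_ (norm_nonneg u))
  have hA : 0 ≤ ∑ i, |a i| := Finset.sum_nonneg fun i _ => abs_nonneg _
  refine Real.sqrt_le_iff.2 ⟨by positivity, ?_⟩
  have h1 : ∀ i, ∑ j, a i * a j * V.toFun (s i) (s j)
      ≤ |a i| * ((∑ i, |a i|) * (B * ‖v‖ ^ (2 * k))) := by
    intro i
    -- The first argument is frozen at `s i`: all `2 * k` derivatives fall on the second.
    have := hB h (fun _ => s i) s (s i).1 p 0 v (by simp) hs (by simp) hp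
    rw [norm_zero, max_eq_right (norm_nonneg v)] at this
    refine (le_abs_self _).trans ?_
    simp_rw [mul_assoc (a i)]
    rw [← Finset.mul_sum, abs_mul]
    exact mul_le_mul_of_nonneg_left this (abs_nonneg _)
  refine (Finset.sum_le_sum fun i _ => h1 i).trans (le_of_eq ?_)
  rw [← Finset.sum_mul, mul_pow, mul_pow, Real.sq_sqrt hB0]
  ring

/-! ### The geometry of the space-time domain -/

theorem exists_spaceTime_cone (hcone : InteriorCone Ω) :
    ∃ c, 0 < c ∧ ∃ l₀, 0 < l₀ ∧ ∀ s ∈ spaceTime Ω, ∃ e : ℝ × EuclideanSpace ℝ (Fin d),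
      ‖e‖ ≤ 1 ∧ ∀ l ∈ Icc 0 l₀, ∀ w : ℝ × EuclideanSpace ℝ (Fin d), ‖w‖ ≤ c * l →
        s + l • e + w ∈ spaceTime Ω := by
  obtain ⟨θ, ρ, hθ0, hθ, hρ, h⟩ := hcone
  have hcos0 : 0 < Real.cos θ := Real.cos_pos_of_mem_Ioo ⟨by linarith, hθ⟩
  have hcos1 : Real.cos θ < 1 := by
    rw [← Real.cos_zero]
    exact Real.cos_lt_cos_of_nonneg_of_le_pi_div_two le_rfl hθ.le hθ0
  -- The solution of `(1 - c) / (1 + c) = cos θ`: a perturbation of `l • ξ` of size `c * l` has norm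
  -- at most `l * (1 + c)` and component at least `l * (1 - c)` along `ξ`, so it stays in the cone.
  set c := (1 - Real.cos θ) / (1 + Real.cos θ) with hc
  have hc0 : 0 < c := div_pos (by linarith) (by linarith)
  have hc1 : c < 1 := by rw [hc, div_lt_one (by linarith)]; linarith
  have hcc : Real.cos θ * (1 + c) = 1 - c := by
    rw [hc]
    field_simp
    ring
  refine ⟨c, hc0, min (1 / 4) (ρ / 2), by positivity, fun s hs => ?_⟩
  obtain ⟨ξ, hξ, hx⟩ := h s.2 hs.2
  have hspace : ∀ l ∈ Icc 0 (min (1 / 4) (ρ / 2)), ∀ w : EuclideanSpace ℝ (Fin d),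
      ‖w‖ ≤ c * l → s.2 + l • ξ + w ∈ Ω := by
    intro l hl w hw
    rcases hl.1.eq_or_lt with rfl | hl0
    · have : w = 0 := by simpa using hw
      simpa [this] using hs.2
    set y := l • ξ + w with hy
    have hlξ : ‖l • ξ‖ = l := by rw [norm_smul, hξ, mul_one, Real.norm_of_nonneg hl.1]
    have hyle : ‖y‖ ≤ l * (1 + c) := by
      refine (norm_add_le _ _).trans ?_
      rw [hlξ]; linarith
    have hyge : l * (1 - c) ≤ ‖y‖ := by
      have := norm_sub_le_norm_add (l • ξ) w
      rw [hlξ] at this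
      linarith
    have hy0 : 0 < ‖y‖ := lt_of_lt_of_le (mul_pos hl0 (by linarith)) hyge
    have hin : l * (1 - c) ≤ ⟪y, ξ⟫ := by
      rw [hy, inner_add_left, inner_smul_left, real_inner_self_eq_norm_sq, hξ]
      have := abs_le.1 (abs_real_inner_le_norm w ξ)
      rw [hξ] at this
      simp only [conj_trivial]
      linarith [this.1]
    have := hx (‖y‖⁻¹ • y) (by rw [norm_smul, norm_inv, norm_norm, inv_mul_cancel₀ hy0.ne']) ?_
      ‖y‖ ⟨norm_nonneg y, ?_⟩
    · rwa [smul_smul, mul_inv_cancel₀ hy0.ne', one_smul, hy, ← add_assoc] at this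
    · rw [inner_smul_left]
      simp only [conj_trivial]
      rw [inv_mul_eq_div, le_div_iff₀ hy0]
      calc Real.cos θ * ‖y‖ ≤ Real.cos θ * (l * (1 + c)) :=
            mul_le_mul_of_nonneg_left hyle hcos0.le
        _ = l * (1 - c) := by rw [← hcc]; ring
        _ ≤ _ := hin
    · have := hl.2.trans (min_le_right _ _)
      nlinarith
  have key : ∀ σ : ℝ, |σ| = 1 → (∀ q : ℝ, |q| ≤ 1 / 2 → 0 ≤ q * σ → s.1 + q ∈ Icc (0 : ℝ) 1) →
      ∃ e : ℝ × EuclideanSpace ℝ (Fin d),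
        ‖e‖ ≤ 1 ∧ ∀ l ∈ Icc 0 (min (1 / 4) (ρ / 2)), ∀ w : ℝ × EuclideanSpace ℝ (Fin d),
          ‖w‖ ≤ c * l → s + l • e + w ∈ spaceTime Ω := by
    intro σ hσ hq
    refine ⟨(σ, ξ), by simp [Prod.norm_def, hσ, hξ], fun l hl w hw => ⟨?_, ?_⟩⟩
    · have h1 : |w.1| ≤ c * l := (norm_fst_le w).trans hw
      have h2 : c * l ≤ l := mul_le_of_le_one_left hl.1 hc1.le
      have h3 : l ≤ 1 / 4 := hl.2.trans (min_le_left _ _)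
      have hσ2 : σ * σ = 1 := by rw [← abs_mul_abs_self, hσ, one_mul]
      have := hq (l * σ + w.1) ?_ ?_
      · simpa [add_assoc] using this
      · refine (abs_add_le _ _).trans ?_
        rw [abs_mul, hσ, abs_of_nonneg hl.1]
        linarith
      · have : |w.1 * σ| ≤ l := by rw [abs_mul, hσ]; linarith
        rw [add_mul, mul_assoc, hσ2]
        linarith [(abs_le.1 this).1]
    · exact hspace l hl w.2 ((norm_snd_le w).trans hw)
  have ht := hs.1
  -- The time direction points away from the nearer end of `[0, 1]`; the displacement is at most `2
  -- * l ≤ 1 / 2`.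
  rcases le_total s.1 (1 / 2) with hlt | hgt
  · refine key 1 (by simp) fun q hq hq0 => ?_
    have := abs_le.1 hq
    exact ⟨by linarith [ht.1], by linarith [this.2]⟩
  · refine key (-1) (by simp) fun q hq hq0 => ?_
    have := abs_le.1 hq
    exact ⟨by linarith [this.1], by linarith [ht.2]⟩

theorem fillDistance_nonneg (S : Finset (spaceTime Ω)) : 0 ≤ fillDistance S :=
  Real.iSup_nonneg fun _ => Real.iInf_nonneg fun _ => Real.sqrt_nonneg _

theorem exists_norm_sub_le_fillDistance (hΩ : Bornology.IsBounded Ω) {S : Finset (spaceTime Ω)}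
    (hS : S.Nonempty) (s : spaceTime Ω) : ∃ s' ∈ S, ‖s.1 - s'.1‖ ≤ fillDistance S := by
  obtain ⟨M, hM⟩ := Metric.isBounded_iff.1 hΩ
  have : Nonempty S := hS.to_subtype
  set f : spaceTime Ω → S → ℝ :=
    fun s s' => √((s.1.1 - s'.1.1.1) ^ 2 + ‖s.1.2 - s'.1.1.2‖ ^ 2) with hf
  have hbdd : BddAbove (range fun s => ⨅ s' : S, f s s') := by
    obtain ⟨s₀⟩ := this
    refine ⟨√(1 + M ^ 2), ?_⟩
    rintro _ ⟨s, rfl⟩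
    refine (ciInf_le ⟨0, by rintro _ ⟨_, rfl⟩; exact Real.sqrt_nonneg _⟩ s₀).trans ?_
    refine Real.sqrt_le_sqrt (add_le_add ?_ ?_)
    · have h1 := s.2.1
      have h2 := s₀.1.2.1
      rw [sq_le_one_iff_abs_le_one, abs_le]
      exact ⟨by linarith [h1.1, h2.2], by linarith [h1.2, h2.1]⟩
    · refine pow_le_pow_left₀ (norm_nonneg _) ?_ 2
      rw [← dist_eq_norm]
      exact hM s.2.2 s₀.1.2.2
  obtain ⟨s', hs'⟩ := exists_eq_ciInf_of_finite (f := f s)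
  refine ⟨s'.1, s'.2, le_trans ?_ (hs'.le.trans (le_ciSup hbdd s))⟩
  -- The norm of the product is the maximum norm, which the Euclidean distance dominates.
  rw [Prod.norm_def]
  refine max_le (Real.le_sqrt_of_sq_le ?_) (Real.le_sqrt_of_sq_le ?_)
  · rw [Real.norm_eq_abs, sq_abs]
    exact le_add_of_nonneg_right (sq_nonneg _)
  · exact le_add_of_nonneg_left (sq_nonneg _)

/-! ### The sampling inequality -/

theorem norm_le_two_mul_of_absorption {X : Type*} {F : Type*} [NormedAddCommGroup F] {u : X → F}
    {N₀ E : ℝ} (h₀ : ∀ x, ‖u x‖ ≤ N₀) (h : ∀ N, (∀ x, ‖u x‖ ≤ N) → ∀ x, ‖u x‖ ≤ N / 2 + E) (x : X) :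
    ‖u x‖ ≤ 2 * E := by
  have hb : BddAbove (range fun x => ‖u x‖) := ⟨N₀, by rintro _ ⟨x, rfl⟩; exact h₀ x⟩
  have : Nonempty X := ⟨x⟩
  have h1 : (⨆ x, ‖u x‖) ≤ (⨆ x, ‖u x‖) / 2 + E := ciSup_le (h _ (le_ciSup hb))
  linarith [le_ciSup hb x]

/-- A function with zeros near the centre of a ball is small at the centre. -/
theorem exists_norm_le_of_near_zero (hΩ : IsOpen Ω) {k : ℕ} {V : MercerKernel (spaceTime Ω)}
    (hV : IsCn (2 * k) V) :
    ∃ A, 0 ≤ A ∧ ∀ (u : V.Space (EuclideanSpace ℝ (Fin d))) (N : ℝ), (∀ s, ‖u s‖ ≤ N) →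
      ∀ (z : spaceTime Ω) (R ϑ : ℝ), 0 ≤ R → 0 ≤ ϑ → ϑ ≤ 1 / 2 →
      (∀ w, ‖w‖ ≤ R → z.1 + w ∈ spaceTime Ω) →
      ∀ s' : spaceTime Ω, ‖z.1 - s'.1‖ ≤ ϑ * R → u s' = 0 →
      ‖u z‖ ≤ A * ϑ * N + A * R ^ k * ‖u‖ := by
  obtain ⟨B, hB0, hB⟩ := hV.exists_norm_sum_le hΩ
  obtain ⟨D, hD0, hD⟩ := exists_annihilates_interpolation (2 * k)
  set n := 2 * k with hn
  refine ⟨max (2 * n * D) ((1 + n * D) * B), le_max_of_le_left (by positivity),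
    fun u N hN z R ϑ hR hϑ hϑ2 hball s' hs' hus' => ?_⟩
  have hN0 : 0 ≤ N := (norm_nonneg _).trans (hN z)
  suffices h : ‖u z‖ ≤ 2 * n * D * ϑ * N + (1 + n * D) * B * R ^ k * ‖u‖ by
    refine h.trans (add_le_add ?_ ?_)
    · gcongr
      exact le_max_left _ _
    · gcongr
      exact le_max_right _ _
  by_cases hz : z = s'
  · rw [hz, hus', norm_zero]
    positivity
  set δ := ‖z.1 - s'.1‖ with hδ
  have hδ0 : 0 < δ := norm_pos_iff.2 (sub_ne_zero.2 fun h => hz (Subtype.ext h))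
  have hRpos : 0 < R := by
    rcases hR.eq_or_lt with h | h
    · rw [← h, mul_zero] at hs'
      linarith
    · exact h
  -- The segment from `s'` in direction `v` has length `R / 2` and meets `z` at the parameter `t = 2
  -- * δ / R ≤ 2 * ϑ ≤ 1`, so it lies in the ball around `z`.
  set v := (R / (2 * δ)) • (z.1 - s'.1) with hv
  have hvn : ‖v‖ = R / 2 := by
    rw [hv, norm_smul, ← hδ, Real.norm_of_nonneg (by positivity)]
    field_simp
  set t := 2 * δ / R with ht
  have ht0 : 0 ≤ t := by positivity
  have htϑ : t ≤ 2 * ϑ := by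
    rw [ht, div_le_iff₀ hRpos]
    linarith
  have htv : z.1 = s'.1 + t • v := by
    rw [hv, smul_smul, ht]
    have : 2 * δ / R * (R / (2 * δ)) = 1 := by field_simp
    rw [this]
    module
  have hseg : ∀ τ ∈ Icc (0 : ℝ) 1, s'.1 + τ • v ∈ spaceTime Ω := fun τ hτ => by
    have h1 : s'.1 + τ • v = z.1 + (τ - t) • v := by
      rw [htv]
      module
    rw [h1]
    refine hball _ ?_
    rw [norm_smul, hvn, Real.norm_eq_abs]
    have : |τ - t| ≤ 1 := abs_le.2 ⟨by linarith [hτ.1], by linarith [hτ.2]⟩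
    nlinarith
  obtain ⟨a, ha, haD, hat⟩ := hD t ⟨ht0, by linarith⟩
  set x : Fin n → spaceTime Ω := fun i => ⟨s'.1 + (i / n : ℝ) • v,
    hseg _ (by simpa using ha.mem i.succ)⟩ with hx
  have key := hB ha u (Fin.cons z x) s'.1 v
    (fun i => Fin.cases (by simpa using htv) (fun i => by simp [hx]) i) hseg
  rw [Fin.sum_univ_succ, Fin.sum_univ_succ] at key
  simp only [Fin.cons_zero, Fin.cons_succ, one_smul, abs_one] at key
  have hsumA : ∑ i, |a i| ≤ n * D := by
    simpa using Finset.sum_le_card_nsmul Finset.univ (fun i => |a i|) D (fun i _ => haD i)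
  have hterm : ∀ i ∈ Finset.univ, ‖a i • u (x i)‖ ≤ D * (2 * ϑ) * N := by
    intro i _
    by_cases hi : (i : ℕ) = 0
    · have : x i = s' := by simp [hx, hi]
      rw [this, hus', smul_zero, norm_zero]
      positivity
    · rw [norm_smul, Real.norm_eq_abs]
      exact mul_le_mul ((hat i hi).trans (mul_le_mul_of_nonneg_left htϑ hD0)) (hN _)
        (norm_nonneg _) (by positivity)
  have hsum : ‖∑ i, a i • u (x i)‖ ≤ n * (D * (2 * ϑ) * N) := by
    refine (norm_sum_le _ _).trans ?_
    simpa using Finset.sum_le_card_nsmul Finset.univ _ _ hterm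
  have hvk : ‖v‖ ^ k ≤ R ^ k := pow_le_pow_left₀ (norm_nonneg v) (by rw [hvn]; linarith) k
  have h2 : ‖u‖ * ((1 + ∑ i, |a i|) * (B * ‖v‖ ^ k)) ≤ ‖u‖ * ((1 + n * D) * (B * R ^ k)) := by
    gcongr
  have h3 := norm_sub_le (u z + ∑ i, a i • u (x i)) (∑ i, a i • u (x i))
  rw [add_sub_cancel_right] at h3
  linarith

/-- The sampling inequality for the functions of the RKHS. -/
theorem IsCn.exists_sampling (hΩ : IsOpen Ω) (hbdd : Bornology.IsBounded Ω)
    (hcone : InteriorCone Ω) {k : ℕ} {V : MercerKernel (spaceTime Ω)} (hV : IsCn (2 * k) V) :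
    ∃ C, 0 < C ∧ ∃ h₀, 0 < h₀ ∧ ∀ S : Finset (spaceTime Ω), S.Nonempty → fillDistance S ≤ h₀ →
      ∀ u : V.Space (EuclideanSpace ℝ (Fin d)), (∀ s ∈ S, u s = 0) →
      ∀ s, ‖u s‖ ≤ C * fillDistance S ^ k * ‖u‖ := by
  obtain ⟨c, hc, l₀, hl₀, hcone⟩ := exists_spaceTime_cone hcone
  obtain ⟨A, hA0, hA⟩ := exists_norm_le_of_near_zero hΩ hV
  obtain ⟨B, hB0, hB⟩ := hV.exists_norm_sum_le hΩ
  obtain ⟨M, hM0, hM⟩ := hV.exists_diag_le hΩ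
  obtain ⟨n, hn⟩ : ∃ n, n = 2 * k := ⟨_, rfl⟩
  rw [← hn] at hB
  obtain ⟨a, ha⟩ := exists_annihilates_extrapolation n
  set α := ∑ i, |a i| with hα
  have hα0 : 0 ≤ α := Finset.sum_nonneg fun i _ => abs_nonneg _
  -- the ratio of the data spacing and the radius of the balls
  obtain ⟨ϑ, hϑ0, hϑ2, hϑ⟩ : ∃ ϑ : ℝ, 0 < ϑ ∧ ϑ ≤ 1 / 2 ∧ α * A * ϑ ≤ 1 / 2 := by
    refine ⟨1 / (2 * (1 + α * A)), by positivity, ?_, ?_⟩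
    · rw [div_le_div_iff₀ (by positivity) (by norm_num)]
      nlinarith [mul_nonneg hα0 hA0]
    · rw [mul_one_div, div_le_div_iff₀ (by positivity) (by norm_num)]
      nlinarith [mul_nonneg hα0 hA0]
  set ρ := c / (n + 1) with hρ
  have hρ0 : 0 < ρ := by positivity
  -- With cone length `l = Λ * h`, the balls of radius `ρ * l` around the nodes satisfy `ϑ * (ρ * l)
  -- = h`, so `S` has a point within `ϑ` times the radius of each centre.
  set Λ := 1 / (ϑ * ρ) with hΛ
  have hΛ0 : 0 < Λ := by positivity
  set E := α * (A * (ρ * Λ) ^ k) + (1 + α) * (B * Λ ^ k) with hE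
  have hE0 : 0 ≤ E := by positivity
  refine ⟨2 * E + 1, by positivity, l₀ / Λ, by positivity, fun S hS hh u hu s => ?_⟩
  set h := fillDistance S with hhdef
  have hh0 : 0 ≤ h := fillDistance_nonneg S
  have main : ∀ s, ‖u s‖ ≤ 2 * (E * h ^ k * ‖u‖) := by
    refine norm_le_two_mul_of_absorption (N₀ := ‖u‖ * √M) (fun s => ?_) fun N hN s => ?_
    · exact (V.norm_apply_le_sqrt u s).trans
        (mul_le_mul_of_nonneg_left (Real.sqrt_le_sqrt (hM s)) (norm_nonneg u))
    obtain ⟨e, he, hball⟩ := hcone s.1 s.2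
    set l := Λ * h with hl
    have hl0 : 0 ≤ l := by positivity
    have hll₀ : l ≤ l₀ := by
      rw [hl, mul_comm]
      exact (le_div_iff₀ hΛ0).1 hh
    have hN0 : 0 ≤ N := (norm_nonneg _).trans (hN s)
    have hseg : ∀ τ ∈ Icc (0 : ℝ) 1, s.1 + τ • (l • e) ∈ spaceTime Ω := fun τ hτ => by
      have := hball (τ * l) ⟨mul_nonneg hτ.1 hl0, (mul_le_of_le_one_left hl0 hτ.2).trans hll₀⟩ 0
        (by rw [norm_zero]; have := hτ.1; positivity)
      rwa [add_zero, ← smul_smul] at this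
    set x : Fin n → spaceTime Ω := fun i => ⟨s.1 + (((i : ℝ) + 1) / n) • (l • e),
      hseg _ (by simpa using ha.mem i.succ)⟩ with hx
    have hxle : ∀ i, ‖u (x i)‖ ≤ A * ϑ * N + A * (ρ * l) ^ k * ‖u‖ := by
      intro i
      obtain ⟨s', hs'S, hs'⟩ := exists_norm_sub_le_fillDistance hbdd hS (x i)
      refine hA u N hN (x i) (ρ * l) ϑ (by positivity) hϑ0.le hϑ2 (fun w hw => ?_) s' ?_ (hu s' hs'S)
      · have hτ := ha.mem i.succ
        simp only [Fin.cons_succ] at hτ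
        have hn0 : (0 : ℝ) < n := by
          have := i.2
          exact_mod_cast (by omega : 0 < n)
        have := hball (((i : ℝ) + 1) / n * l)
          ⟨mul_nonneg hτ.1 hl0, (mul_le_of_le_one_left hl0 hτ.2).trans hll₀⟩ w ?_
        · rwa [← smul_smul] at this
        · refine hw.trans ?_
          rw [hρ, ← mul_assoc c, div_eq_mul_one_div c]
          refine mul_le_mul_of_nonneg_right (mul_le_mul_of_nonneg_left ?_ hc.le) hl0
          rw [div_le_div_iff₀ (by positivity) hn0]
          have : (0 : ℝ) ≤ i := by positivity
          nlinarith
      · refine hs'.trans (le_of_eq ?_)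
        rw [hl, hΛ]
        field_simp
        rfl
    have key := hB ha u (Fin.cons s x) s.1 (l • e)
      (fun i => Fin.cases (by simp) (fun i => by simp [hx]) i) hseg
    rw [Fin.sum_univ_succ, Fin.sum_univ_succ] at key
    simp only [Fin.cons_zero, Fin.cons_succ, one_smul, abs_one] at key
    rw [← hα] at key
    have hsum : ‖∑ i, a i • u (x i)‖ ≤ α * (A * ϑ * N + A * (ρ * l) ^ k * ‖u‖) := by
      refine (norm_sum_le _ _).trans ?_
      rw [hα, Finset.sum_mul]
      refine Finset.sum_le_sum fun i _ => ?_
      rw [norm_smul, Real.norm_eq_abs]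
      exact mul_le_mul_of_nonneg_left (hxle i) (abs_nonneg _)
    have hek : ‖l • e‖ ^ k ≤ l ^ k := by
      refine pow_le_pow_left₀ (norm_nonneg _) ?_ k
      rw [norm_smul, Real.norm_of_nonneg hl0]
      exact mul_le_of_le_one_right hl0 he
    have h2 : ‖u‖ * ((1 + α) * (B * ‖l • e‖ ^ k)) ≤ ‖u‖ * ((1 + α) * (B * l ^ k)) := by
      gcongr
    have h3 := norm_sub_le (u s + ∑ i, a i • u (x i)) (∑ i, a i • u (x i))
    rw [add_sub_cancel_right] at h3
    have h4 : α * A * ϑ * N ≤ 1 / 2 * N := mul_le_mul_of_nonneg_right hϑ hN0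
    have h5 : E * h ^ k * ‖u‖
        = α * (A * (ρ * l) ^ k * ‖u‖) + ‖u‖ * ((1 + α) * (B * l ^ k)) := by
      rw [hE, hl]
      ring
    rw [h5]
    linarith
  refine (main s).trans ?_
  have : 0 ≤ h ^ k * ‖u‖ := by positivity
  nlinarith

/-! ### Grönwall's inequality with an integrable coefficient -/

theorem le_mul_exp_of_le_add_integral_of_continuous {g e : ℝ → ℝ} {a : ℝ} (hg : Continuous g)
    (hg0 : ∀ t, 0 ≤ g t) (he : Continuous e)
    (h : ∀ t ∈ Icc (0 : ℝ) 1, e t ≤ a + ∫ s in (0 : ℝ)..t, g s * e s) :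
    e 1 ≤ a * Real.exp (∫ s in (0 : ℝ)..1, g s) := by
  set y : ℝ → ℝ := fun t => a + ∫ s in (0 : ℝ)..t, g s * e s with hy
  set G : ℝ → ℝ := fun t => ∫ s in (0 : ℝ)..t, g s with hG
  have hy' : ∀ t, HasDerivAt y (g t * e t) t := fun t =>
    (((hg.mul he).integral_hasStrictDerivAt 0 t).hasDerivAt).const_add a
  have hG' : ∀ t, HasDerivAt G (g t) t := fun t => (hg.integral_hasStrictDerivAt 0 t).hasDerivAt
  set z : ℝ → ℝ := fun t => y t * Real.exp (-G t) with hz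
  have hz' : ∀ t, HasDerivAt z
      (g t * e t * Real.exp (-G t) + y t * (Real.exp (-G t) * -g t)) t := fun t =>
    (hy' t).mul ((hG' t).neg.exp)
  have hanti : AntitoneOn z (Icc 0 1) := by
    refine antitoneOn_of_deriv_nonpos (convex_Icc 0 1)
      (fun t _ => (hz' t).continuousAt.continuousWithinAt)
      (fun t _ => (hz' t).differentiableAt.differentiableWithinAt) fun t ht => ?_
    rw [(hz' t).deriv]
    have h1 := h t (interior_subset ht)
    have h2 : 0 ≤ g t * Real.exp (-G t) := mul_nonneg (hg0 t) (Real.exp_pos _).le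
    have h3 : e t ≤ y t := h1
    nlinarith
  have h01 : z 1 ≤ z 0 := hanti (by simp) (by simp) zero_le_one
  have hz0 : z 0 = a := by simp [hz, hy, hG]
  rw [hz0] at h01
  calc e 1 ≤ y 1 := h 1 (by simp)
    _ = z 1 * Real.exp (G 1) := by
      simp only [hz]
      rw [mul_assoc, ← Real.exp_add, neg_add_cancel, Real.exp_zero, mul_one]
    _ ≤ a * Real.exp (G 1) := mul_le_mul_of_nonneg_right h01 (Real.exp_pos _).le

/-- An integrable `L` is approximated in `L¹` by a continuous `g ≥ 0` up to `δ`. As `e ≤ M` on `[0,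
1]`, this adds at most `δ * M` to `a` and `δ` to the exponent; then `δ → 0`. -/
theorem le_mul_exp_of_le_add_integral {L e : ℝ → ℝ} {a : ℝ}
    (hL : IntegrableOn L (Icc 0 1)) (hL0 : ∀ t, 0 ≤ L t) (he : Continuous e)
    (he0 : ∀ t, 0 ≤ e t) (ha : 0 ≤ a)
    (h : ∀ t ∈ Icc (0 : ℝ) 1, e t ≤ a + ∫ s in (0 : ℝ)..t, L s * e s) :
    e 1 ≤ a * Real.exp (∫ s in Icc (0 : ℝ) 1, L s) := by
  obtain ⟨M, hM⟩ := isCompact_Icc.exists_bound_of_continuousOn (s := Icc (0 : ℝ) 1) he.continuousOn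
  have hM0 : 0 ≤ M := (norm_nonneg _).trans (hM 0 (by simp))
  have hM' : ∀ t ∈ Icc (0 : ℝ) 1, e t ≤ M := fun t ht => (le_abs_self _).trans (hM t ht)
  have key : ∀ δ > 0, e 1 ≤ (a + δ * M) * Real.exp ((∫ s in Icc (0 : ℝ) 1, L s) + δ) := by
    intro δ hδ
    obtain ⟨g₀, -, hLg₀, hg₀, hg₀i⟩ := hL.exists_hasCompactSupport_integral_sub_le hδ
    set g : ℝ → ℝ := fun t => max (g₀ t) 0 with hgdef
    have hg : Continuous g := hg₀.max continuous_const
    have hg0 : ∀ t, 0 ≤ g t := fun t => le_max_right _ _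
    have hgi : IntegrableOn g (Icc 0 1) := hg.continuousOn.integrableOn_Icc
    have hLg : ∫ s in Icc (0 : ℝ) 1, |L s - g s| ≤ δ := by
      refine (integral_mono_ae (hL.sub hgi).abs (hL.sub hg₀i).norm
        (Eventually.of_forall fun t => ?_)).trans hLg₀
      have := abs_max_sub_max_le_abs (L t) (g₀ t) 0
      rwa [max_eq_left (hL0 t)] at this
    have hint : ∫ s in (0 : ℝ)..1, g s ≤ (∫ s in Icc (0 : ℝ) 1, L s) + δ := by
      rw [intervalIntegral.integral_of_le zero_le_one, ← integral_Icc_eq_integral_Ioc]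
      have h1 : ∫ s in Icc (0 : ℝ) 1, g s
          ≤ ∫ s in Icc (0 : ℝ) 1, (L s + |L s - g s|) :=
        integral_mono_ae hgi (hL.add (hL.sub hgi).abs) (Eventually.of_forall fun t => by
          have := neg_abs_le (L t - g t)
          simp only
          linarith)
      have hLgi : IntegrableOn (fun s => |L s - g s|) (Icc 0 1) := (hL.sub hgi).abs
      rw [integral_add hL hLgi] at h1
      linarith
    refine (le_mul_exp_of_le_add_integral_of_continuous (a := a + δ * M) hg hg0 he
      fun t ht => ?_).trans
      (mul_le_mul_of_nonneg_left (Real.exp_le_exp.2 hint) (by positivity))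
    refine (h t ht).trans ?_
    have hsub : Ioc 0 t ⊆ Icc (0 : ℝ) 1 := fun s hs => ⟨hs.1.le, hs.2.trans ht.2⟩
    have hLe : IntegrableOn (fun s => L s * e s) (Icc 0 1) :=
      hL.mul_continuousOn he.continuousOn isCompact_Icc
    have hge : IntegrableOn (fun s => g s * e s) (Icc 0 1) :=
      (hg.mul he).continuousOn.integrableOn_Icc
    have habs : IntegrableOn (fun s => |L s - g s| * M) (Icc 0 1) :=
      ((hL.sub hgi).abs).mul_const M
    have h2 : ∫ s in Ioc 0 t, L s * e s ≤ ∫ s in Ioc 0 t, (g s * e s + |L s - g s| * M) := by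
      refine setIntegral_mono_on (hLe.mono_set hsub) ((hge.add habs).mono_set hsub)
        measurableSet_Ioc fun s hs => ?_
      have h3 : (L s - g s) * e s ≤ |L s - g s| * M :=
        mul_le_mul (le_abs_self _) (hM' s (hsub hs)) (he0 s) (abs_nonneg _)
      linarith
    rw [integral_add (hge.mono_set hsub) (habs.mono_set hsub)] at h2
    have h4 : ∫ s in Ioc 0 t, |L s - g s| * M ≤ δ * M := by
      refine (setIntegral_mono_set habs (Eventually.of_forall fun s =>
        mul_nonneg (abs_nonneg _) hM0) hsub.eventuallyLE).trans ?_
      rw [integral_mul_const]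
      exact mul_le_mul_of_nonneg_right hLg hM0
    rw [intervalIntegral.integral_of_le ht.1, intervalIntegral.integral_of_le ht.1]
    linarith
  have hcont : Continuous fun δ : ℝ =>
      (a + δ * M) * Real.exp ((∫ s in Icc (0 : ℝ) 1, L s) + δ) := by fun_prop
  have hlim := (hcont.tendsto 0).mono_left (nhdsWithin_le_nhds (s := Ioi 0))
  simp only [zero_mul, add_zero] at hlim
  exact ge_of_tendsto hlim (eventually_nhdsWithin_of_forall key)

/-! ### Trajectories -/

theorem zeroExt_of_mem (v : spaceTime Ω → EuclideanSpace ℝ (Fin d)) {t : ℝ}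
    {x : EuclideanSpace ℝ (Fin d)} (h : (t, x) ∈ spaceTime Ω) : zeroExt v t x = v ⟨(t, x), h⟩ :=
  dif_pos h

theorem zeroExt_of_notMem (v : spaceTime Ω → EuclideanSpace ℝ (Fin d)) (t : ℝ)
    {x : EuclideanSpace ℝ (Fin d)} (h : x ∉ Ω) : zeroExt v t x = 0 :=
  dif_neg fun h' => h h'.2

theorem IsTrajectory.mem {v : spaceTime Ω → EuclideanSpace ℝ (Fin d)}
    {x : EuclideanSpace ℝ (Fin d)} {φ : ℝ → EuclideanSpace ℝ (Fin d)} (h : IsTrajectory v x φ)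
    {t : ℝ} (ht : t ∈ Icc (0 : ℝ) 1) : φ t ∈ Ω := (h.2 t ht).1

theorem IsTrajectory.hasDerivWithinAt {v : spaceTime Ω → EuclideanSpace ℝ (Fin d)}
    {x : EuclideanSpace ℝ (Fin d)} {φ : ℝ → EuclideanSpace ℝ (Fin d)} (h : IsTrajectory v x φ)
    {t : ℝ} (ht : t ∈ Icc (0 : ℝ) 1) :
    HasDerivWithinAt φ (zeroExt v t (φ t)) (Icc 0 1) t := by
  obtain ⟨hφ, hd⟩ := h.2 t ht
  rwa [zeroExt_of_mem v ⟨ht, hφ⟩]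

theorem IsTrajectory.continuousOn {v : spaceTime Ω → EuclideanSpace ℝ (Fin d)}
    {x : EuclideanSpace ℝ (Fin d)} {φ : ℝ → EuclideanSpace ℝ (Fin d)} (h : IsTrajectory v x φ) :
    ContinuousOn φ (Icc 0 1) := fun _ ht => (h.hasDerivWithinAt ht).continuousWithinAt

theorem continuousOn_zeroExt_comp {v : spaceTime Ω → EuclideanSpace ℝ (Fin d)}
    (hv : Continuous v) {φ : ℝ → EuclideanSpace ℝ (Fin d)} (hφ : ContinuousOn φ (Icc 0 1))
    (hmem : ∀ t ∈ Icc (0 : ℝ) 1, φ t ∈ Ω) :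
    ContinuousOn (fun t => zeroExt v t (φ t)) (Icc 0 1) := by
  rw [continuousOn_iff_continuous_domRestrict] at hφ ⊢
  have h1 : Continuous fun t : Icc (0 : ℝ) 1 =>
      (⟨(t.1, φ t), t.2, hmem t t.2⟩ : spaceTime Ω) :=
    (continuous_subtype_val.prodMk hφ).subtype_mk _
  refine (hv.comp h1).congr fun t => ?_
  exact (zeroExt_of_mem v (⟨t.2, hmem t t.2⟩ : (t.1, φ t) ∈ spaceTime Ω)).symm

/-- Stability of trajectories with respect to the initial value and the vector field. -/
theorem IsTrajectory.norm_sub_le {u v : spaceTime Ω → EuclideanSpace ℝ (Fin d)}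
    (hu : Continuous u) (hv : Continuous v) {x y : EuclideanSpace ℝ (Fin d)}
    {φ ψ : ℝ → EuclideanSpace ℝ (Fin d)} (hφ : IsTrajectory u x φ) (hψ : IsTrajectory v y ψ)
    {ε : ℝ} (hε : ∀ s, ‖u s - v s‖ ≤ ε) (hε0 : 0 ≤ ε) {L : ℝ → ℝ} (hL : IntegrableOn L (Icc 0 1))
    (hL0 : ∀ t, 0 ≤ L t)
    (hLip : ∀ᵐ t ∂(volume.restrict (Icc (0 : ℝ) 1)), ∀ a ∈ Ω, ∀ b ∈ Ω,
      ‖zeroExt v t a - zeroExt v t b‖ ≤ L t * ‖a - b‖) :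
    ‖φ 1 - ψ 1‖ ≤ (‖x - y‖ + ε) * Real.exp (∫ t in Icc (0 : ℝ) 1, L t) := by
  set D : ℝ → EuclideanSpace ℝ (Fin d) := fun t => zeroExt u t (φ t) - zeroExt v t (ψ t) with hD
  have hDc : ContinuousOn D (Icc 0 1) :=
    (continuousOn_zeroExt_comp hu hφ.continuousOn fun t ht => hφ.mem ht).sub
      (continuousOn_zeroExt_comp hv hψ.continuousOn fun t ht => hψ.mem ht)
  set e : ℝ → ℝ := IccExtend (zero_le_one (α := ℝ))
    ((Icc (0 : ℝ) 1).domRestrict fun t => ‖φ t - ψ t‖) with he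
  have heq : ∀ t ∈ Icc (0 : ℝ) 1, e t = ‖φ t - ψ t‖ := fun t ht => by
    rw [he, IccExtend_of_mem _ _ ht]
    rfl
  have hec : Continuous e :=
    (continuousOn_iff_continuous_domRestrict.1 (hφ.continuousOn.sub hψ.continuousOn).norm).Icc_extend'
  have he0 : ∀ t, 0 ≤ e t := fun t => norm_nonneg _
  rw [← heq 1 (by simp)]
  refine le_mul_exp_of_le_add_integral hL hL0 hec he0 (by positivity) fun t ht => ?_
  have hsub : Icc 0 t ⊆ Icc (0 : ℝ) 1 := Icc_subset_Icc_right ht.2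
  have hsub' : Ioc 0 t ⊆ Icc (0 : ℝ) 1 := Ioc_subset_Icc_self.trans hsub
  have hFTC := intervalIntegral.integral_eq_sub_of_hasDerivAt_of_le (f := fun s => φ s - ψ s)
    (f' := D) ht.1 ((hφ.continuousOn.sub hψ.continuousOn).mono hsub) (fun s hs => by
      have hs' : s ∈ Ioo (0 : ℝ) 1 := ⟨hs.1, hs.2.trans_le ht.2⟩
      have hnhds : Icc (0 : ℝ) 1 ∈ nhds s := Icc_mem_nhds hs'.1 hs'.2
      exact ((hφ.hasDerivWithinAt (Ioo_subset_Icc_self hs')).hasDerivAt hnhds).sub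
        ((hψ.hasDerivWithinAt (Ioo_subset_Icc_self hs')).hasDerivAt hnhds))
    ((hDc.mono hsub).intervalIntegrable_of_Icc ht.1)
  rw [hφ.1, hψ.1] at hFTC
  have h1 : φ t - ψ t = (x - y) + ∫ s in (0 : ℝ)..t, D s := by rw [hFTC]; abel
  have hLe : IntegrableOn (fun s => L s * e s) (Icc 0 1) :=
    hL.mul_continuousOn hec.continuousOn isCompact_Icc
  have hεi : IntegrableOn (fun _ : ℝ => ε) (Ioc 0 t) := by
    simp
  have h2 : ∫ s in Ioc 0 t, ‖D s‖ ≤ ∫ s in Ioc 0 t, (ε + L s * e s) := by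
    refine setIntegral_mono_ae_restrict ((hDc.norm.integrableOn_Icc).mono_set hsub')
      (hεi.add (hLe.mono_set hsub')) ?_
    filter_upwards [ae_restrict_of_ae_restrict_of_subset hsub' hLip,
      ae_restrict_mem measurableSet_Ioc] with s hs hst
    have hs1 := hsub' hst
    rw [heq s hs1]
    have h3 : D s = (zeroExt u s (φ s) - zeroExt v s (φ s))
        + (zeroExt v s (φ s) - zeroExt v s (ψ s)) := by simp only [hD]; abel
    rw [h3]
    refine (norm_add_le _ _).trans (add_le_add ?_ (hs _ (hφ.mem hs1) _ (hψ.mem hs1)))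
    rw [zeroExt_of_mem u ⟨hs1, hφ.mem hs1⟩, zeroExt_of_mem v ⟨hs1, hφ.mem hs1⟩]
    exact hε _
  rw [integral_add hεi (hLe.mono_set hsub')] at h2
  have h4 : ∫ _ in Ioc 0 t, ε ≤ ε := by
    simp [ht.1]
    exact mul_le_of_le_one_left hε0 ht.2
  rw [heq t ht, h1]
  refine (norm_add_le _ _).trans ?_
  have h5 := intervalIntegral.norm_integral_le_integral_norm (f := D) (μ := volume) ht.1
  simp only [intervalIntegral.integral_of_le ht.1] at h5 ⊢
  linarith

/-- Bounded continuous fields whose extensions by zero are Lipschitz have trajectories in `Ω`. -/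
theorem exists_isTrajectory {v : spaceTime Ω → EuclideanSpace ℝ (Fin d)} (hv : Continuous v)
    {N K : ℝ≥0} (hN : ∀ s, ‖v s‖ ≤ N) (hK : ∀ t ∈ Icc (0 : ℝ) 1, LipschitzWith K (zeroExt v t))
    {x : EuclideanSpace ℝ (Fin d)} (hx : x ∈ Ω) : ∃ φ, IsTrajectory v x φ := by
  have hPL : IsPicardLindelof (zeroExt v) (tmin := 0) (tmax := 1) ⟨0, by simp⟩ x N 0 N K := by
    refine ⟨fun t ht => (hK t ht).lipschitzOnWith, fun y _ => ?_, fun t ht y _ => ?_, by simp⟩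
    · by_cases hy : y ∈ Ω
      · exact continuousOn_zeroExt_comp hv continuousOn_const fun _ _ => hy
      · simp_rw [zeroExt_of_notMem v _ hy]
        exact continuousOn_const
    · by_cases hy : y ∈ Ω
      · rw [zeroExt_of_mem v ⟨ht, hy⟩]
        exact hN _
      · rw [zeroExt_of_notMem v _ hy, norm_zero]
        exact N.2
  obtain ⟨φ, hφ0, hφ⟩ := hPL.exists_eq_forall_mem_Icc_hasDerivWithinAt₀
  -- Points outside `Ω` are stationary for the extended field, so by backward uniqueness a solution
  -- that reached one would have started there.
  have hmem : ∀ t ∈ Icc (0 : ℝ) 1, φ t ∈ Ω := by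
    intro t ht
    by_contra hnot
    have hsub : Icc 0 t ⊆ Icc (0 : ℝ) 1 := Icc_subset_Icc_right ht.2
    have h := ODE_solution_unique_of_mem_Icc_left (v := zeroExt v) (K := K) (a := 0) (b := t)
      (s := fun _ => univ) (f := φ) (g := fun _ => φ t)
      (fun s hs => (hK s (hsub (Ioc_subset_Icc_self hs))).lipschitzOnWith)
      (fun s hs => ((hφ s (hsub hs)).continuousWithinAt).mono hsub)
      (fun s hs => ?_) (fun _ _ => trivial) continuousOn_const
      (fun s _ => by simpa [zeroExt_of_notMem v s hnot] using hasDerivWithinAt_const s (Iic s) (φ t))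
      (fun _ _ => trivial) rfl
    · have h0 := h (left_mem_Icc.2 ht.1)
      simp only at h0
      rw [← h0] at hnot
      exact hnot (hφ0 ▸ hx)
    · have hs1 := hsub (Ioc_subset_Icc_self hs)
      refine (hφ s hs1).mono_of_mem_nhdsWithin ?_
      refine mem_of_superset (Icc_mem_nhdsLE hs.1) (Icc_subset_Icc_right hs1.2)
  refine ⟨φ, hφ0, fun t ht => ⟨hmem t ht, ?_⟩⟩
  have := hφ t ht
  rwa [zeroExt_of_mem v ⟨ht, hmem t ht⟩] at this

/-! ### Continuity of the fields and of their extensions by zero -/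

theorem IsCn.continuous_uncurry {n : ℕ} {V : MercerKernel (spaceTime Ω)} (hV : IsCn n V) :
    Continuous fun p : spaceTime Ω × spaceTime Ω => V.toFun p.1 p.2 := by
  obtain ⟨G, hGV, hG, -⟩ := hV
  have h : Continuous fun p : spaceTime Ω × spaceTime Ω => G (p.1, p.2) :=
    hG.continuousOn.comp_continuous (by fun_prop) fun p => ⟨p.1.2, p.2.2⟩
  exact h.congr fun p => hGV p.1 p.2

theorem IsCn.continuous_coe {n : ℕ} {V : MercerKernel (spaceTime Ω)} (hV : IsCn n V)
    (u : V.Space (EuclideanSpace ℝ (Fin d))) : Continuous u := by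
  have hc := hV.continuous_uncurry
  refine continuous_iff_continuousAt.2 fun s => tendsto_iff_norm_sub_tendsto_zero.2 ?_
  have h1 : Continuous fun s' : spaceTime Ω =>
      ‖u‖ * √(V.toFun s' s' - V.toFun s' s - V.toFun s s' + V.toFun s s) := by
    have e1 : Continuous fun s' => V.toFun s' s' := hc.comp (continuous_id.prodMk continuous_id)
    have e2 : Continuous fun s' => V.toFun s' s := V.continuous_left s
    have e3 : Continuous fun s' => V.toFun s s' := V.continuous_right s
    fun_prop
  have h2 := h1.tendsto s
  simp only [sub_self, zero_sub, neg_add_cancel, Real.sqrt_zero, mul_zero] at h2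
  exact squeeze_zero (fun _ => norm_nonneg _) (fun s' => V.norm_sub_apply_le u s' s) h2

/-- The Lipschitz bound holds along the segment from `x` towards `y` up to its first exit point from
`Ω`. There the extension is zero, and continuity passes the bound to the limit. -/
theorem norm_zeroExt_le_of_notMem (hΩ : IsOpen Ω) {u : spaceTime Ω → EuclideanSpace ℝ (Fin d)}
    {κ : ℝ} (hκ : 0 ≤ κ)
    (hseg : ∀ s s' : spaceTime Ω,
      (∀ t ∈ Icc (0 : ℝ) 1, s.1 + t • (s'.1 - s.1) ∈ spaceTime Ω) →
      ‖u s - u s'‖ ≤ κ * ‖s'.1 - s.1‖) {t : ℝ} (ht : t ∈ Icc (0 : ℝ) 1)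
    (hc : Continuous (zeroExt u t)) {x y : EuclideanSpace ℝ (Fin d)} (hx : x ∈ Ω) (hy : y ∉ Ω) :
    ‖zeroExt u t x‖ ≤ κ * ‖x - y‖ := by
  set γ : ℝ → EuclideanSpace ℝ (Fin d) := fun τ => x + τ • (y - x) with hγ
  have hγc : Continuous γ := by fun_prop
  obtain ⟨b, ⟨hb1, hbΩ⟩, hmin⟩ := (isCompact_Icc.inter_right
    (hΩ.isClosed_compl.preimage hγc)).exists_isLeast (s := Icc (0 : ℝ) 1 ∩ γ ⁻¹' Ωᶜ)
    ⟨1, by simp, by simpa [hγ] using hy⟩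
  have hin : ∀ τ, 0 ≤ τ → τ < b → γ τ ∈ Ω := fun τ h0 h1 => by
    by_contra h
    exact absurd (hmin ⟨⟨h0, h1.le.trans hb1.2⟩, h⟩) (not_le.2 h1)
  have hb0 : 0 < b := by
    rcases hb1.1.eq_or_lt with h | h
    · rw [← h] at hbΩ
      exact absurd (by simpa [hγ] using hx) hbΩ
    · exact h
  have hle : ∀ τ ∈ Ioo 0 b, ‖zeroExt u t x - zeroExt u t (γ τ)‖ ≤ κ * ‖x - y‖ := by
    intro τ hτ
    have hmem := hin τ hτ.1.le hτ.2
    rw [zeroExt_of_mem u ⟨ht, hx⟩, zeroExt_of_mem u ⟨ht, hmem⟩]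
    have hdiff : ((t, γ τ) : ℝ × EuclideanSpace ℝ (Fin d)) - (t, x) = (0, τ • (y - x)) := by
      simp [hγ]
    refine (hseg ⟨(t, x), ht, hx⟩ ⟨(t, γ τ), ht, hmem⟩ fun σ hσ => ?_).trans ?_
    · simp only [hdiff]
      refine ⟨by simpa using ht, ?_⟩
      have := hin (σ * τ) (mul_nonneg hσ.1 hτ.1.le)
        ((mul_le_of_le_one_left hτ.1.le hσ.2).trans_lt hτ.2)
      simpa [hγ, mul_smul] using this
    · simp only [hdiff]
      refine mul_le_mul_of_nonneg_left ?_ hκ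
      rw [Prod.norm_mk, norm_zero, max_eq_right (norm_nonneg _), norm_smul,
        Real.norm_of_nonneg hτ.1.le, norm_sub_rev y x]
      exact mul_le_of_le_one_left (norm_nonneg _) (hτ.2.le.trans hb1.2)
  have hlim : Tendsto (fun τ => ‖zeroExt u t x - zeroExt u t (γ τ)‖) (nhdsWithin b (Iio b))
      (nhds ‖zeroExt u t x - zeroExt u t (γ b)‖) :=
    ((continuous_const.sub (hc.comp hγc)).norm.tendsto b).mono_left nhdsWithin_le_nhds
  rw [zeroExt_of_notMem u t hbΩ, sub_zero] at hlim
  refine le_of_tendsto hlim ?_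
  filter_upwards [Ioo_mem_nhdsLT hb0] with τ hτ using hle τ hτ

/-- If the segment between two points of `Ω` leaves `Ω` at `b`, the two values are bounded by `κ`
times the distances to `b`, which add up to `‖x - y‖`. No convexity is needed and the constant stays
`κ`. -/
theorem lipschitzWith_zeroExt (hΩ : IsOpen Ω) {u : spaceTime Ω → EuclideanSpace ℝ (Fin d)}
    {κ : ℝ≥0} (hu : Continuous u)
    (hseg : ∀ s s' : spaceTime Ω,
      (∀ t ∈ Icc (0 : ℝ) 1, s.1 + t • (s'.1 - s.1) ∈ spaceTime Ω) →
      ‖u s - u s'‖ ≤ κ * ‖s'.1 - s.1‖)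
    (hae : ∀ᵐ t ∂(volume.restrict (Icc (0 : ℝ) 1)), Continuous (zeroExt u t))
    {t : ℝ} (ht : t ∈ Icc (0 : ℝ) 1) : LipschitzWith κ (zeroExt u t) := by
  have hbd : ∀ x ∈ Ω, ∀ y ∉ Ω, ‖zeroExt u t x‖ ≤ κ * ‖x - y‖ := by
    intro x hx y hy
    -- The embedding gives continuity in space only for almost every `t`. Writing the bound as an
    -- equality with a maximum extends it to all `t` by continuity in time.
    have h1 : ContinuousOn (fun t => max ‖zeroExt u t x‖ (κ * ‖x - y‖)) (Icc 0 1) :=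
      (continuousOn_zeroExt_comp hu continuousOn_const fun _ _ => hx).norm.sup continuousOn_const
    have h2 : (fun t => max ‖zeroExt u t x‖ (κ * ‖x - y‖))
        =ᵐ[volume.restrict (Icc (0 : ℝ) 1)] fun _ => κ * ‖x - y‖ := by
      filter_upwards [hae, ae_restrict_mem measurableSet_Icc] with t hc ht
      exact max_eq_right (norm_zeroExt_le_of_notMem hΩ κ.2 hseg ht hc hx hy)
    exact max_eq_right_iff.1
      (Measure.eqOn_Icc_of_ae_eq volume zero_ne_one h2 h1 continuousOn_const ht)
  refine LipschitzWith.of_dist_le_mul fun x y => ?_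
  rw [dist_eq_norm, dist_eq_norm]
  by_cases hx : x ∈ Ω <;> by_cases hy : y ∈ Ω
  · by_cases h : ∀ τ ∈ Icc (0 : ℝ) 1, x + τ • (y - x) ∈ Ω
    · rw [zeroExt_of_mem u ⟨ht, hx⟩, zeroExt_of_mem u ⟨ht, hy⟩]
      refine (hseg _ _ fun τ hτ => ⟨by simpa using ht, by simpa using h τ hτ⟩).trans ?_
      simp [norm_sub_rev]
    · push Not at h
      obtain ⟨τ, hτ, hb⟩ := h
      refine (norm_sub_le _ _).trans ((add_le_add (hbd x hx _ hb) (hbd y hy _ hb)).trans ?_)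
      have h1 : x - (x + τ • (y - x)) = τ • (x - y) := by module
      have h2 : y - (x + τ • (y - x)) = (1 - τ) • (y - x) := by module
      rw [h1, h2, norm_smul, norm_smul, Real.norm_of_nonneg hτ.1,
        Real.norm_of_nonneg (sub_nonneg.2 hτ.2), norm_sub_rev y x]
      exact le_of_eq (by ring)
  · rw [zeroExt_of_notMem u t hy, sub_zero]
    exact hbd x hx y hy
  · rw [zeroExt_of_notMem u t hx, zero_sub, norm_neg, norm_sub_rev]
    exact hbd y hy x hx
  · rw [zeroExt_of_notMem u t hx, zeroExt_of_notMem u t hy, sub_zero, norm_zero]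
    positivity

/-! ### The Lipschitz part of the Bochner norm -/

namespace LipZero

theorem norm_sub_le_lipPart (f : LipZero Ω) {a b : EuclideanSpace ℝ (Fin d)} (ha : a ∈ Ω)
    (hb : b ∈ Ω) : ‖f.1 a - f.1 b‖ ≤ lipPart f * ‖a - b‖ := by
  rcases eq_or_ne a b with rfl | hab
  · simp
  · rw [← div_le_iff₀ (norm_pos_iff.2 (sub_ne_zero.2 hab))]
    exact le_ciSup (bddAbove_lipPart f) (⟨a, ha⟩, ⟨b, hb⟩)

theorem lipPart_le_add (f g : LipZero Ω) : lipPart f ≤ lipPart g + ‖f - g‖ := by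
  have h0 : lipPart (f - g) ≤ ‖f - g‖ := le_add_of_nonneg_left (supPart_nonneg _)
  refine le_trans ?_ (add_le_add_right h0 _)
  refine Real.iSup_le (fun p => ?_) (add_nonneg (lipPart_nonneg _) (lipPart_nonneg _))
  refine div_le_of_le_mul₀ (norm_nonneg _) (add_nonneg (lipPart_nonneg _) (lipPart_nonneg _)) ?_
  have h1 := norm_sub_le_lipPart g p.1.2 p.2.2
  have h2 := norm_sub_le_lipPart (f - g) p.1.2 p.2.2
  have h3 : f.1 p.1 - f.1 p.2 = (g.1 p.1 - g.1 p.2) + ((f - g).1 p.1 - (f - g).1 p.2) := by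
    change _ = _ + ((f.1 p.1 - g.1 p.1) - (f.1 p.2 - g.1 p.2))
    abel
  rw [h3, add_mul]
  exact (norm_add_le _ _).trans (add_le_add h1 h2)

theorem abs_lipPart_sub_le (f g : LipZero Ω) : |lipPart f - lipPart g| ≤ ‖f - g‖ := by
  have h1 := lipPart_le_add f g
  have h2 := lipPart_le_add g f
  rw [norm_sub_rev] at h2
  exact abs_le.2 ⟨by linarith, by linarith⟩

theorem continuous_lipPart : Continuous (lipPart : LipZero Ω → ℝ) :=
  (LipschitzWith.of_dist_le_mul (K := 1) fun f g => by
    simpa [Real.dist_eq, dist_eq_norm] using abs_lipPart_sub_le f g).continuous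

theorem lipPart_smul (c : ℝ) (f : LipZero Ω) : lipPart (c • f) = |c| * lipPart f := by
  simp only [lipPart, Real.mul_iSup_of_nonneg (abs_nonneg c)]
  simp [coe_smul, ← smul_sub, norm_smul, mul_div_assoc]

theorem lipPart_eq_zero_of_supPart {f : LipZero Ω} (h : supPart f = 0) : lipPart f = 0 := by
  have h0 : ∀ x ∈ Ω, f.1 x = 0 := fun x hx => by
    have := le_ciSup (bddAbove_supPart f) ⟨x, hx⟩
    rw [← supPart, h] at this
    simpa using this
  simp only [lipPart, h0 _ (Subtype.coe_prop _), sub_self, norm_zero, zero_div]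
  exact Real.iSup_const_zero

end LipZero

/-- The part `∫₀¹ sup_{x, y} |v(t, x) - v(t, y)| / |x - y| dt` of the norm. -/
def lipIntegral (u : VelocitySpace Ω) : ℝ := ∫ t in Icc (0 : ℝ) 1, LipZero.lipPart (u t)

theorem integrable_lipPart (u : VelocitySpace Ω) :
    IntegrableOn (fun t => LipZero.lipPart (u t)) (Icc (0 : ℝ) 1) := by
  refine (L1.integrable_coeFn u).norm.mono'
    (LipZero.continuous_lipPart.comp_aestronglyMeasurable (Lp.aestronglyMeasurable u))
    (Eventually.of_forall fun t => ?_)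
  rw [Real.norm_of_nonneg (LipZero.lipPart_nonneg _)]
  exact le_add_of_nonneg_left (LipZero.supPart_nonneg _)

theorem lipIntegral_nonneg (u : VelocitySpace Ω) : 0 ≤ lipIntegral u :=
  integral_nonneg fun _ => LipZero.lipPart_nonneg _

theorem continuous_lipIntegral : Continuous (lipIntegral : VelocitySpace Ω → ℝ) := by
  refine (LipschitzWith.of_dist_le_mul (K := 1) fun u v => ?_).continuous
  rw [Real.dist_eq, dist_eq_norm, NNReal.coe_one, one_mul, L1.norm_eq_integral_norm, lipIntegral,
    lipIntegral, ← integral_sub (integrable_lipPart u) (integrable_lipPart v)]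
  refine (abs_integral_le_integral_abs).trans (integral_mono_ae
    ((integrable_lipPart u).sub (integrable_lipPart v)).abs (L1.integrable_coeFn _).norm ?_)
  filter_upwards [Lp.coeFn_sub u v] with t ht
  rw [ht]
  exact LipZero.abs_lipPart_sub_le _ _

theorem lipIntegral_smul (c : ℝ) (u : VelocitySpace Ω) :
    lipIntegral (c • u) = |c| * lipIntegral u := by
  rw [lipIntegral, lipIntegral, ← integral_const_mul]
  refine integral_congr_ae ?_
  filter_upwards [Lp.coeFn_smul c u] with t ht
  rw [ht]
  exact LipZero.lipPart_smul _ _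

/-- Equality would force the supremum part to vanish almost everywhere, hence `u = 0` on `Ω` and the
Lipschitz part to vanish too, against `0 < C`. -/
theorem lipIntegral_lt_of_norm_le {u : VelocitySpace Ω} {C : ℝ} (hC : 0 < C) (hu : ‖u‖ ≤ C) :
    lipIntegral u < C := by
  by_contra! h
  have hsup : Integrable (fun t => LipZero.supPart (u t)) (volume.restrict (Icc (0 : ℝ) 1)) :=
    ((L1.integrable_coeFn u).norm.sub (integrable_lipPart u)).congr
      (Eventually.of_forall fun t => by simp [LipZero.norm_def])
  have h1 : ‖u‖ = (∫ t in Icc (0 : ℝ) 1, LipZero.supPart (u t)) + lipIntegral u := by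
    rw [L1.norm_eq_integral_norm, lipIntegral, ← integral_add hsup (integrable_lipPart u)]
    rfl
  have h2 : ∫ t in Icc (0 : ℝ) 1, LipZero.supPart (u t) = 0 :=
    le_antisymm (by linarith) (integral_nonneg fun _ => LipZero.supPart_nonneg _)
  rw [integral_eq_zero_iff_of_nonneg (fun _ => LipZero.supPart_nonneg _) hsup] at h2
  have h3 : lipIntegral u = 0 := by
    refine integral_eq_zero_of_ae ?_
    filter_upwards [h2] with t ht using LipZero.lipPart_eq_zero_of_supPart ht
  linarith

/-- By compactness, the Lipschitz part of the norm is strictly smaller than the embedding bound. -/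
theorem exists_lipIntegral_le {H : Type*} [NormedAddCommGroup H] [NormedSpace ℝ H] {C : ℝ}
    (hC : 0 < C) {ι : H →L[ℝ] VelocitySpace Ω} (hι : IsCompactOperator ι)
    (hb : ∀ v, ‖ι v‖ ≤ C * ‖v‖) :
    ∃ β, 0 ≤ β ∧ β < C ∧ ∀ v, lipIntegral (ι v) ≤ β * ‖v‖ := by
  -- The continuous `lipIntegral` attains its maximum over the compact closure of the image of the
  -- unit ball, so the strict inequality for single elements becomes a uniform one.
  have hK := hι.isCompact_closure_image_closedBall (f := ι.toLinearMap) 1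
  obtain ⟨w, hw, hmax⟩ := hK.exists_isMaxOn
    ⟨ι 0, subset_closure ⟨0, by simp, rfl⟩⟩ continuous_lipIntegral.continuousOn
  have hwC : ‖w‖ ≤ C := by
    have : closure (ι.toLinearMap '' Metric.closedBall 0 1) ⊆ Metric.closedBall 0 C := by
      refine closure_minimal ?_ Metric.isClosed_closedBall
      rintro _ ⟨v, hv, rfl⟩
      rw [mem_closedBall_zero_iff] at hv ⊢
      exact (hb v).trans (mul_le_of_le_one_right hC.le hv)
    exact mem_closedBall_zero_iff.1 (this hw)
  refine ⟨lipIntegral w, lipIntegral_nonneg w, lipIntegral_lt_of_norm_le hC hwC, fun v => ?_⟩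
  rcases eq_or_ne v 0 with rfl | hv
  · have := lipIntegral_smul 0 (0 : VelocitySpace Ω)
    simp at this
    simp [this]
  · have hv0 : 0 < ‖v‖ := norm_pos_iff.2 hv
    have h1 : lipIntegral (ι (‖v‖⁻¹ • v)) ≤ lipIntegral w := hmax (subset_closure
      ⟨‖v‖⁻¹ • v, by simp [norm_smul, hv0.ne'], rfl⟩)
    rw [map_smul, lipIntegral_smul, abs_of_pos (inv_pos.2 hv0), inv_mul_le_iff₀ hv0] at h1
    linarith

/-! ### Transport maps of the functions of the RKHS -/

theorem exists_isTrajectory_transport {v : spaceTime Ω → EuclideanSpace ℝ (Fin d)} {x : Ω}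
    (h : ∃ φ, IsTrajectory v x φ) :
    ∃ φ, IsTrajectory v x φ ∧ φ 1 = (transport v x : EuclideanSpace ℝ (Fin d)) :=
  ⟨h.choose, h.choose_spec, by rw [transport, dif_pos h]⟩

theorem CompactlyEmbedded.exists_isTrajectory (hΩ : IsOpen Ω) {n : ℕ} (hn : 2 ≤ n)
    {V : MercerKernel (spaceTime Ω)} (hV : IsCn n V) {C : ℝ} (hQ : CompactlyEmbedded V C)
    (u : V.Space (EuclideanSpace ℝ (Fin d))) (x : Ω) : ∃ φ, IsTrajectory u x φ := by
  obtain ⟨ι, hι, -⟩ := hQ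
  obtain ⟨B, hB0, hB⟩ := hV.exists_lipschitz hΩ hn
  obtain ⟨M, hM0, hM⟩ := hV.exists_diag_le hΩ
  have hae : ∀ᵐ t ∂(volume.restrict (Icc (0 : ℝ) 1)), Continuous (zeroExt u t) := by
    filter_upwards [hι u] with t ht
    rw [← ht]
    obtain ⟨L, hL⟩ := (ι u t).2.2.1
    exact hL.continuous
  refine KODE.exists_isTrajectory (hV.continuous_coe u) (N := ⟨‖u‖ * √M, by positivity⟩)
    (K := ⟨‖u‖ * B, by positivity⟩) (fun s => ?_) (fun t ht => ?_) x.2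
  · exact (V.norm_apply_le_sqrt u s).trans
      (mul_le_mul_of_nonneg_left (Real.sqrt_le_sqrt (hM s)) (norm_nonneg u))
  · refine lipschitzWith_zeroExt hΩ (hV.continuous_coe u) (fun s s' h => ?_) hae ht
    exact (hB u s s' h).trans (le_of_eq (mul_assoc _ _ _).symm)

theorem CompactlyEmbedded.exists_dist_transport_le (hΩ : IsOpen Ω) {n : ℕ} (hn : 2 ≤ n)
    {V : MercerKernel (spaceTime Ω)} (hV : IsCn n V) {C : ℝ} (hC : 0 < C)
    (hQ : CompactlyEmbedded V C) :
    ∃ β, 0 ≤ β ∧ β < C ∧ ∀ (u v : V.Space (EuclideanSpace ℝ (Fin d))) (ε : ℝ), 0 ≤ ε →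
      (∀ s, ‖u s - v s‖ ≤ ε) → ∀ x y : Ω,
      dist (transport u x) (transport v y) ≤ (dist x y + ε) * Real.exp (β * ‖v‖) := by
  have htraj := fun u x => hQ.exists_isTrajectory hΩ hn hV u x
  obtain ⟨ι, hι, hιc, hιn⟩ := hQ
  obtain ⟨β, hβ0, hβC, hβ⟩ := exists_lipIntegral_le hC hιc hιn
  refine ⟨β, hβ0, hβC, fun u v ε hε0 hε x y => ?_⟩
  obtain ⟨φ, hφ, hφ1⟩ := exists_isTrajectory_transport (htraj u x)
  obtain ⟨ψ, hψ, hψ1⟩ := exists_isTrajectory_transport (htraj v y)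
  have key := hφ.norm_sub_le (hV.continuous_coe u) (hV.continuous_coe v) hψ hε hε0
    (integrable_lipPart (ι v)) (fun t => LipZero.lipPart_nonneg _) (by
      filter_upwards [hι v] with t ht a ha b hb
      rw [← ht]
      exact LipZero.norm_sub_le_lipPart _ ha hb)
  rw [hφ1, hψ1, ← dist_eq_norm, ← dist_eq_norm] at key
  exact key.trans (mul_le_mul_of_nonneg_left (Real.exp_le_exp.2 (hβ v)) (by positivity))

/-! ### Projection onto the span of the inducing points -/

theorem MercerKernel.exists_mem_inducingBall {X : Type*} [TopologicalSpace X]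
    (K : MercerKernel X) {F : Type*} [NormedAddCommGroup F] [InnerProductSpace ℝ F]
    [CompleteSpace F] [FiniteDimensional ℝ F] (S : Finset X) {r : ℝ} {v : K.Space F}
    (hv : v ∈ K.ball F r) :
    ∃ w ∈ K.inducingBall F S r, ‖w‖ ≤ ‖v‖ ∧ ‖v - w‖ ≤ ‖v‖ ∧ ∀ s ∈ S, (v - w) s = 0 := by
  classical
  set Φ : (S → F) →ₗ[ℝ] K.Space F :=
    ∑ s : S, (RKHS.kerFun (K.Space F) s.1).toLinearMap ∘ₗ LinearMap.proj s with hΦ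
  have hΦa : ∀ c, Φ c = ∑ s : S, RKHS.kerFun (K.Space F) s.1 (c s) := fun c => by
    simp [hΦ]
  set W := LinearMap.range Φ with hW
  obtain ⟨w, hw, hvw⟩ : ∃ w ∈ W, v - w ∈ Wᗮ :=
    ⟨W.starProjection v, W.starProjection_apply_mem v, W.sub_starProjection_mem_orthogonal v⟩
  have hpyth : ‖v‖ ^ 2 = ‖w‖ ^ 2 + ‖v - w‖ ^ 2 := by
    have h0 : ⟪w, v - w⟫ = 0 := Submodule.inner_right_of_mem_orthogonal hw hvw
    have h1 := norm_add_sq_real w (v - w)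
    rw [add_sub_cancel, h0] at h1
    linarith
  have hwv : ‖w‖ ≤ ‖v‖ := (sq_le_sq₀ (norm_nonneg _) (norm_nonneg _)).1
    (by nlinarith [sq_nonneg ‖v - w‖])
  refine ⟨w, ?_, hwv, (sq_le_sq₀ (norm_nonneg _) (norm_nonneg _)).1
    (by nlinarith [sq_nonneg ‖w‖]), fun s hs => ?_⟩
  · obtain ⟨c, rfl⟩ := hw
    have hc : ∀ s : S, Function.extend Subtype.val c 0 s.1 = c s := fun s =>
      Subtype.val_injective.extend_apply c 0 s
    have hsum : Φ c = ∑ s ∈ S, RKHS.kerFun (K.Space F) s (Function.extend Subtype.val c 0 s) := by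
      rw [hΦa, ← Finset.sum_coe_sort S]
      exact Finset.sum_congr rfl fun s _ => by rw [hc]
    refine ⟨_, hsum, ?_⟩
    have hn : ‖Φ c‖ ^ 2 ≤ r ^ 2 := le_trans (pow_le_pow_left₀ (norm_nonneg _) hwv 2) hv
    refine le_trans (le_of_eq ?_) hn
    rw [← real_inner_self_eq_norm_sq, hsum, sum_inner]
    refine Finset.sum_congr rfl fun s _ => ?_
    rw [inner_sum]
    exact Finset.sum_congr rfl fun s' _ => (K.inner_kerFun_kerFun _ _ _ _).symm
  · refine ext_inner_left ℝ fun c => ?_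
    rw [← RKHS.kerFun_inner, inner_zero_right]
    refine Submodule.inner_right_of_mem_orthogonal ?_ hvw
    refine ⟨Pi.single ⟨s, hs⟩ c, ?_⟩
    rw [hΦa, Finset.sum_eq_single ⟨s, hs⟩]
    · simp
    · intro b _ hb
      simp [hb]
    · simp

/-! ### Stability of the maximum mean discrepancy -/

theorem MercerKernel.norm_feature {X : Type*} [TopologicalSpace X] (K : MercerKernel X) (x : X) :
    ‖K.feature x‖ = √(K.toFun x x) := by
  have h := K.inner_kerFun_kerFun (F := ℝ) x x 1 1
  rw [real_inner_self_eq_norm_sq] at h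
  rw [feature, ← Real.sqrt_sq (norm_nonneg (RKHS.kerFun (K.Space ℝ) x 1)), h]
  simp

theorem MercerKernel.FeatureLipschitz.continuous {X : Type*} [PseudoMetricSpace X]
    {K : MercerKernel X} {L : ℝ} (hL0 : 0 ≤ L) (hL : K.FeatureLipschitz L) :
    Continuous K.feature :=
  (LipschitzWith.of_dist_le_mul (K := ⟨L, hL0⟩) fun x y => by
    rw [dist_eq_norm]; exact hL x y).continuous

/-- The mean embedding of `η.map T` is `∫ K(T x, ·) dη`, and the integrands for `T` and `T'` differ
by at most `L * δ`. Integrability survives the transport because `Ω` is bounded, so features move by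
a bounded amount. -/
theorem MercerKernel.FeatureLipschitz.mmd_map_le (hbdd : Bornology.IsBounded Ω)
    {K : MercerKernel Ω} {L : ℝ} (hL0 : 0 ≤ L) (hL : K.FeatureLipschitz L) {η ν : Measure Ω}
    (hη : K.IsAdmissible η) {T T' : Ω → Ω} (hT : Measurable T) (hT' : Measurable T') {δ : ℝ}
    (hδ : ∀ x, dist (T x) (T' x) ≤ δ) :
    K.mmd (η.map T') ν ≤ L * δ + K.mmd (η.map T) ν := by
  obtain ⟨hprob, hint⟩ := hη
  have hc := hL.continuous hL0
  obtain ⟨M, hM⟩ := Metric.isBounded_iff.1 hbdd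
  have hmean : ∀ {T : Ω → Ω}, Measurable T →
      K.meanEmbedding (η.map T) = ∫ x, K.feature (T x) ∂η := fun hT =>
    integral_map hT.aemeasurable hc.aestronglyMeasurable
  have hi : ∀ {T : Ω → Ω}, Measurable T → Integrable (fun x => K.feature (T x)) η := by
    intro T hT
    refine (hint.add (integrable_const (L * M))).mono'
      (hc.stronglyMeasurable.comp_measurable hT).aestronglyMeasurable
      (Eventually.of_forall fun x => ?_)
    have h1 := norm_add_le (K.feature x) (K.feature (T x) - K.feature x)
    rw [add_sub_cancel, K.norm_feature x] at h1
    refine h1.trans (add_le_add le_rfl ((hL _ _).trans ?_))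
    exact mul_le_mul_of_nonneg_left (hM (T x).2 x.2) hL0
  have hdiff : ‖K.meanEmbedding (η.map T') - K.meanEmbedding (η.map T)‖ ≤ L * δ := by
    rw [hmean hT, hmean hT', ← integral_sub (hi hT') (hi hT)]
    refine (norm_integral_le_of_norm_le_const (C := L * δ)
      (Eventually.of_forall fun x => ?_)).trans (by simp)
    refine (hL _ _).trans (mul_le_mul_of_nonneg_left ?_ hL0)
    rw [dist_comm]
    exact hδ x
  rw [mmd, mmd, ← sub_add_sub_cancel (K.meanEmbedding (η.map T')) (K.meanEmbedding (η.map T))]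
  exact (norm_add_le _ _).trans (add_le_add_left hdiff _)

/-- Split `exp (C * r)` as `exp (β * r) * exp ((C - β) * r)` and use `1 + y ≤ exp y` in the second
factor. The gap `C - β` pays for the linear factor `r`. -/
theorem mul_exp_le_of_lt {β C r : ℝ} (hβ : 0 ≤ β) (hβC : β < C) (hr : 0 ≤ r) :
    r * Real.exp (β * r) ≤ (Real.exp (C * r) - 1) / (C - β) := by
  rw [le_div_iff₀ (sub_pos.2 hβC)]
  have h1 : Real.exp (C * r) = Real.exp (β * r) * Real.exp ((C - β) * r) := by
    rw [← Real.exp_add]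
    congr 1
    ring
  have h2 := Real.add_one_le_exp ((C - β) * r)
  have h3 : 1 ≤ Real.exp (β * r) := Real.one_le_exp (by positivity)
  rw [h1]
  nlinarith

end KODE

end

theorem mainTheorem2 {d : ℕ} (Ω : Set (EuclideanSpace ℝ (Fin d)))
    (hΩ_open : IsOpen Ω) (hΩ_bdd : Bornology.IsBounded Ω) (hΩ_cone : KODE.InteriorCone Ω)
    (k : ℕ) (hk : 1 ≤ k)
    (V : KODE.MercerKernel (KODE.spaceTime Ω)) (hV : KODE.IsCn (2 * k) V)
    (CQ : ℝ) (hCQ : 0 < CQ) (hQ : KODE.CompactlyEmbedded V CQ) :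
    ∃ C > 0, ∃ h₀ > 0,
      ∀ (K : KODE.MercerKernel Ω) (LK : ℝ), 0 < LK → K.FeatureLipschitz LK →
      ∀ η ν : Measure Ω, K.IsAdmissible η → K.IsAdmissible ν →
      ∀ r : ℝ, 0 < r →
      ∀ S : Finset (KODE.spaceTime Ω), S.Nonempty → KODE.fillDistance S ≤ h₀ →
      ∀ vr ∈ V.ball (EuclideanSpace ℝ (Fin d)) r,
        IsMinOn (fun v : V.Space (EuclideanSpace ℝ (Fin d)) => KODE.loss K η ν v) (V.ball (EuclideanSpace ℝ (Fin d)) r) vr →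
      ∀ vrS ∈ V.inducingBall (EuclideanSpace ℝ (Fin d)) S r,
        IsMinOn (fun v : V.Space (EuclideanSpace ℝ (Fin d)) => KODE.loss K η ν v)
          (V.inducingBall (EuclideanSpace ℝ (Fin d)) S r) vrS →
        KODE.loss K η ν vrS
          ≤ C * LK * (Real.exp (CQ * r) - 1) * KODE.fillDistance S ^ k
            + KODE.loss K η ν vr := by
  obtain ⟨Cs, hCs, h₀, hh₀, hsamp⟩ := hV.exists_sampling hΩ_open hΩ_bdd hΩ_cone
  obtain ⟨β, hβ0, hβC, hβ⟩ := hQ.exists_dist_transport_le hΩ_open (by omega : 2 ≤ 2 * k) hV hCQ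
  refine ⟨Cs / (CQ - β), div_pos hCs (sub_pos.2 hβC), h₀, hh₀, ?_⟩
  intro K LK hLK hK η ν hη _ r hr S hS hSh vr hvr _ vrS _ hmin
  obtain ⟨w, hw, hwn, hvwn, hzero⟩ := V.exists_mem_inducingBall S hvr
  have hvr' : ‖vr‖ ≤ r := (sq_le_sq₀ (norm_nonneg _) hr.le).1 hvr
  set h := KODE.fillDistance S
  have hh : 0 ≤ h := KODE.fillDistance_nonneg S
  have hε : ∀ s, ‖vr s - w s‖ ≤ Cs * h ^ k * r := fun s => by
    have := hsamp S hS hSh (vr - w) hzero s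
    rw [RKHS.coe_sub, Pi.sub_apply] at this
    exact this.trans (mul_le_mul_of_nonneg_left (hvwn.trans hvr') (by positivity))
  -- Stability with equal fields and `ε = 0` makes each transport map Lipschitz.
  have hmeas : ∀ u : V.Space (EuclideanSpace ℝ (Fin d)), Measurable (KODE.transport u) :=
    fun u => (LipschitzWith.of_dist_le_mul (K := ⟨Real.exp (β * ‖u‖), (Real.exp_pos _).le⟩)
      fun x y => by
        have := hβ u u 0 le_rfl (fun s => by simp) x y
        rwa [add_zero, mul_comm] at this).continuous.measurable
  have hδ : ∀ x, dist (KODE.transport vr x) (KODE.transport w x)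
      ≤ Cs * h ^ k * ((Real.exp (CQ * r) - 1) / (CQ - β)) := fun x => by
    refine (hβ vr w _ (by positivity) hε x x).trans ?_
    rw [dist_self, zero_add, mul_assoc]
    refine mul_le_mul_of_nonneg_left (le_trans ?_ (KODE.mul_exp_le_of_lt hβ0 hβC hr.le))
      (by positivity)
    exact mul_le_mul_of_nonneg_left (Real.exp_le_exp.2
      (mul_le_mul_of_nonneg_left (hwn.trans hvr') hβ0)) hr.le
  refine (isMinOn_iff.1 hmin w hw).trans
    ((hK.mmd_map_le hΩ_bdd hLK.le hη (hmeas vr) (hmeas w) hδ).trans (le_of_eq ?_))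
  rw [KODE.loss]
  ring
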